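/- Let $n\ge 1$. For $\mu\in\mathbb R^n$, a positive definite (symmetric) real $n\times n$ matrix $\Sigma$ and $\psi:\mathbb R\to\mathbb R$, write $\mathrm{Ell}_n(\mu,\Sigma,\psi)$ for the probability law on $\mathbb R^n$ with characteristic function $t\mapsto e^{i t'\mu}\,\psi(t'\Sigma t)$, when there is one. Let $X\sim \mathrm{Ell}_n(\mu^x,\Sigma^x,\psi)$ and $Y\sim \mathrm{Ell}_n(\mu^y,\Sigma^y,\psi)$, with $\Sigma^x,\Sigma^y$ positive definite. Let $R\ge 0$ be the generating variate: $X$ has the same law as $\mu^x+R\,A'U$, where $A'A=\Sigma^x$, $U$ is uniformly distributed on the unit sphere $S^{n-1}$, and $R$ and $U$ are independent. Assume $E(R^2)<\infty$. For $0\le\lambda\le1$ put $$\mu_\lambda=\lambda\mu^y+(1-\lambda)\mu^x,\qquad \Sigma_\lambda=\lambda\Sigma^y+(1-\lambda)\Sigma^x ,$$ and suppose that $\mathrm{Ell}_n(\mu_\lambda,\Sigma_\lambda,\psi)$ has a probability density $\phi_\lambda$ for every such $\lambda$. Let $$\psi_1(u)=\frac1{E(R^2)}\int_0^\infty {}_0F_1\!\left(\frac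 n2+1;-\frac{r^2u}{4}\right)r^2\,P(R\in dr),\qquad {}_0F_1(\gamma;z)=\sum_{k=0}^\infty\frac1{(\gamma)_k}\frac{z^k}{k!},$$ where $(\gamma)_k=\gamma(\gamma+1)\cdots(\gamma+k-1)$. Let $f:\mathbb R^n\to\mathbb R$ be twice continuously differentiable, with gradient $\nabla f$ and Hessian matrix $\mathbf H_f$, such that $f(x)=O(\|x\|)$ and $\nabla f(x)=O(\|x\|)$ as $\|x\|\to\infty$. Then for every $\lambda\in[0,1]$ the law $\mathrm{Ell}_n(\mu_\lambda,\Sigma_\lambda,\psi_1)$ exists and has a probability density. Let $\phi_{1\lambda}$ be any such density. If, for almost every $\lambda\in[0,1]$, the function $x\mapsto \mathrm{tr}\{(\Sigma^y-\Sigma^x)\mathbf H_f(x)\}\,\phi_{1\lambda}(x)$ is Lebesgue integrable on $\mathbb R^n$, then all expectations and the other integrals (inner and outer) in the following formula exist as well, and $$E[f(Y)]-E[f(X)]=\int_0^1\!\int_{\mathbb R^n}(\mu^y-\mu^x)'\nabla f(x)\,\phi_\lambda(x)\,dx\,d\lambda+\frac{E(R^2)}{2n}\int_0^1\!\int_{\mathbb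 R^n}\mathrm{tr}\{(\Sigma^y-\Sigma^x)\mathbf H_f(x)\}\,\phi_{1\lambda}(x)\,dx\,d\lambda .$$ -/

import Mathlib

open MeasureTheory ProbabilityTheory

namespace Elliptical

noncomputable section

/-- The generalized hypergeometric series `₀F₁(γ; z) = ∑ₖ zᵏ / ((γ)ₖ k!)`, where
`(γ)ₖ = γ (γ + 1) ⋯ (γ + k - 1)`; it converges absolutely for every real `z` when `γ > 0`. -/
def hyp0F1 (γ z : ℝ) : ℝ :=
  ∑' k : ℕ, 1 / (ascPochhammer ℝ k).eval γ * (z ^ k / (k.factorial : ℝ))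

/-- The uniform distribution on the unit sphere of `ℝⁿ` (normalized surface measure), as a measure
on `ℝⁿ`. -/
def uniformSphere (n : ℕ) : Measure (EuclideanSpace ℝ (Fin n)) :=
  (((volume : Measure (EuclideanSpace ℝ (Fin n))).toSphere Set.univ)⁻¹ •
    (volume : Measure (EuclideanSpace ℝ (Fin n))).toSphere).map Subtype.val

/-- The product `A x` of a matrix and a column vector of `ℝⁿ`. -/
def mulVec {n : ℕ} (A : Matrix (Fin n) (Fin n) ℝ) (x : EuclideanSpace ℝ (Fin n)) :
    EuclideanSpace ℝ (Fin n) :=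
  WithLp.toLp 2 (A.mulVec x.ofLp)

/-- `ν` is the elliptical distribution `Ell_n(m, S, ψ)`: a probability measure on `ℝⁿ` whose
characteristic function is `t ↦ exp(i t'm) ψ(t' S t)`. Only the values of `ψ` on `[0, ∞)` matter
when `S` is positive semidefinite. -/
def IsEllipticalLaw {n : ℕ} (m : EuclideanSpace ℝ (Fin n)) (S : Matrix (Fin n) (Fin n) ℝ)
    (ψ : ℝ → ℝ) (ν : Measure (EuclideanSpace ℝ (Fin n))) : Prop :=
  IsProbabilityMeasure ν ∧
    ∀ t : EuclideanSpace ℝ (Fin n),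
      charFun ν t =
        Complex.exp (Complex.I * ((inner ℝ t m : ℝ) : ℂ)) * ((ψ (inner ℝ t (mulVec S t)) : ℝ) : ℂ)

/-- `p` is a probability density function (with respect to Lebesgue measure) of `Ell_n(m, S, ψ)`. -/
def IsEllipticalDensity {n : ℕ} (m : EuclideanSpace ℝ (Fin n)) (S : Matrix (Fin n) (Fin n) ℝ)
    (ψ : ℝ → ℝ) (p : EuclideanSpace ℝ (Fin n) → ℝ) : Prop :=
  Measurable p ∧ (∀ x, 0 ≤ p x) ∧
    IsEllipticalLaw m S ψ (volume.withDensity fun x => ENNReal.ofReal (p x))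

/-- The function `ψ₁(u) = E(R²)⁻¹ ∫ ₀F₁(n/2 + 1; -r²u/4) r² P(R ∈ dr)`, where `ρ` is the law of
`R ≥ 0`. -/
def psi1 (n : ℕ) (ρ : Measure ℝ) (u : ℝ) : ℝ :=
  1 / (∫ r, r ^ 2 ∂ρ) * ∫ r, hyp0F1 ((n : ℝ) / 2 + 1) (-(r ^ 2 * u) / 4) * r ^ 2 ∂ρ

/-- The Hessian matrix `(∂²f / ∂xᵢ∂xⱼ (x))ᵢⱼ`. -/
def hessian {n : ℕ} (f : EuclideanSpace ℝ (Fin n) → ℝ) (x : EuclideanSpace ℝ (Fin n)) :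
    Matrix (Fin n) (Fin n) ℝ :=
  Matrix.of fun i j =>
    fderiv ℝ (fun y => fderiv ℝ f y (EuclideanSpace.single j 1)) x (EuclideanSpace.single i 1)

/-- The point `l b + (1 - l) a` of the segment from `a` to `b`. -/
def interp {V : Type*} [AddCommGroup V] [Module ℝ V] (a b : V) (l : ℝ) : V :=
  l • b + (1 - l) • a

end

end Elliptical

/-!
Elliptical laws are affine images of spherical ones, and the formula is the fundamental theorem of
calculus along a path of affine maps, followed by the divergence theorem on balls.

Let `ρ` be the law of `R`, let `Z = R U` (`sphereMixture`), a spherical law with generator `ψ`.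
Diagonalizing `Sx = C C'` and `Sy = C D C'` simultaneously, the law `Ell(m_l, S_l, ψ)` is that of
`T_l Z = m_l + ∑ᵢ √(l dᵢ + 1 - l) Zᵢ cᵢ` (`path`), where the `cᵢ` are the columns of `C`. Since `f`
and its gradient grow at most linearly and `E(R²) < ∞`, one may differentiate `f (T_l Z)` in `l`,
integrate over `[0, 1]` and exchange the integrals (`integral_path_sub`). The derivative of `m_l`
gives the gradient term, and that of the scale gives
`E ∑ᵢ Zᵢ (dᵢ - 1) / (2 √(l dᵢ + 1 - l)) ∂f(T_l Z)(cᵢ)`.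

To turn the latter into a Hessian term, the divergence theorem on the unit ball
(`divergence_uniformBall`) reads `n E[⟨F(U), U⟩] = E[div F(B)]` with `B` uniform on the ball. Scaled
by `r` and integrated over `ρ`, it says `E⟨F(Z), Z⟩ = (E(R²) / n) E[div F(Z₁)]`, where `Z₁ = R₁ B`
and the law of `R₁` is `r² ρ(dr) / E(R²)` (`ballMixture`, `integral_sphereMixture_sum_eq`). The law
of `Z₁` is spherical with generator `psi1`: by polar coordinates and the divergence theorem, the
even moments of `⟨t, B⟩` obey the two-term recursion of the coefficients of `₀F₁(n/2 + 1; -‖t‖²/4)`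
(`charFun_uniformBall`). It has a density because `B` has one and `R₁ > 0`; here `E(R²) > 0`, as
otherwise `X` would be constant and have no density.

The divergence theorem itself comes from integrating by parts against the Lipschitz tent functions
`(r - ‖x‖)₊` (`integral_tent_eq`) and differentiating in `r`.
-/

namespace Elliptical

variable {n : ℕ}

/-! ### Uniform distributions on the sphere and the ball, polar coordinates -/

/-- The uniform distribution on the unit ball of `ℝⁿ`: normalized Lebesgue measure. -/
noncomputable def uniformBall (n : ℕ) : Measure (EuclideanSpace ℝ (Fin n)) :=
  (volume (Metric.ball (0 : EuclideanSpace ℝ (Fin n)) 1))⁻¹ •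
    (volume : Measure (EuclideanSpace ℝ (Fin n))).restrict (Metric.ball 0 1)

lemma isProbabilityMeasure_uniformBall (n : ℕ) : IsProbabilityMeasure (uniformBall n) := by
  refine ⟨?_⟩
  simp only [uniformBall, Measure.smul_apply, Measure.restrict_apply_univ, smul_eq_mul]
  exact ENNReal.inv_mul_cancel (Metric.measure_ball_pos _ _ one_pos).ne' measure_ball_lt_top.ne

lemma isProbabilityMeasure_uniformSphere (hn : 0 < n) :
    IsProbabilityMeasure (uniformSphere n) := by
  have : NeZero n := ⟨hn.ne'⟩
  rw [uniformSphere]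
  refine @Measure.isProbabilityMeasure_map _ _ _ _ _ ⟨?_⟩ _ (by fun_prop)
  simp only [Measure.smul_apply, smul_eq_mul]
  refine ENNReal.inv_mul_cancel ?_ (measure_ne_top _ _)
  rw [Ne, Measure.measure_univ_eq_zero]
  exact Measure.toSphere_ne_zero _

lemma ae_norm_eq_one_uniformSphere (n : ℕ) : ∀ᵐ u ∂(uniformSphere n), ‖u‖ = 1 := by
  rw [uniformSphere, ae_map_iff (by fun_prop) (measurableSet_eq_fun (by fun_prop) (by fun_prop))]
  exact Filter.Eventually.of_forall fun u => by simp

lemma ae_norm_lt_one_uniformBall (n : ℕ) : ∀ᵐ x ∂(uniformBall n), ‖x‖ < 1 := by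
  refine Measure.ae_smul_measure ?_ _
  filter_upwards [ae_restrict_mem Metric.isOpen_ball.measurableSet] with x hx
  simpa using hx

lemma uniformBall_absolutelyContinuous (n : ℕ) : uniformBall n ≪ volume :=
  (Measure.absolutelyContinuous_of_le Measure.restrict_le_self).smul_left _

lemma integrable_uniformSphere_of_continuous (hn : 0 < n) {k : EuclideanSpace ℝ (Fin n) → ℝ}
    (hk : Continuous k) : Integrable k (uniformSphere n) := by
  have := isProbabilityMeasure_uniformSphere hn
  obtain ⟨C, hC⟩ := (isCompact_sphere (0 : EuclideanSpace ℝ (Fin n)) 1).exists_bound_of_continuousOn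
    hk.continuousOn
  refine .of_bound hk.aestronglyMeasurable C ?_
  filter_upwards [ae_norm_eq_one_uniformSphere n] with u hu
  exact hC u (by simpa using hu)

lemma integrable_uniformBall_of_continuous {k : EuclideanSpace ℝ (Fin n) → ℝ}
    (hk : Continuous k) : Integrable k (uniformBall n) := by
  have := isProbabilityMeasure_uniformBall n
  obtain ⟨C, hC⟩ := (isCompact_closedBall (0 : EuclideanSpace ℝ (Fin n))
    1).exists_bound_of_continuousOn hk.continuousOn
  refine .of_bound hk.aestronglyMeasurable C ?_
  filter_upwards [ae_norm_lt_one_uniformBall n] with u hu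
  exact hC u (by simpa using hu.le)

/-- Integration in polar coordinates, in terms of the normalized surface measure. -/
lemma integral_polar (hn : 0 < n) {g : EuclideanSpace ℝ (Fin n) → ℝ} (hg : Integrable g) :
    ∫ x, g x = (n * volume.real (Metric.ball (0 : EuclideanSpace ℝ (Fin n)) 1)) *
      ∫ s in Set.Ioi (0 : ℝ), s ^ (n - 1) * ∫ u, g (s • u) ∂(uniformSphere n) := by
  have : NeZero n := ⟨hn.ne'⟩
  set μ : Measure (EuclideanSpace ℝ (Fin n)) := volume
  have hdim : Module.finrank ℝ (EuclideanSpace ℝ (Fin n)) = n := by simp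
  have hmp := μ.measurePreserving_homeomorphUnitSphereProd
  have hme := (homeomorphUnitSphereProd (EuclideanSpace ℝ (Fin n))).measurableEmbedding
  let G : Metric.sphere (0 : EuclideanSpace ℝ (Fin n)) 1 × Set.Ioi (0 : ℝ) → ℝ :=
    fun p => g ((p.2 : ℝ) • (p.1 : EuclideanSpace ℝ (Fin n)))
  have hG : ∀ x : ({0}ᶜ : Set (EuclideanSpace ℝ (Fin n))),
      G (homeomorphUnitSphereProd _ x) = g x := by
    intro x
    have : ‖(x : EuclideanSpace ℝ (Fin n))‖ ≠ 0 := norm_ne_zero_iff.2 x.2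
    simp [G, smul_smul, this]
  have hGint : Integrable G (μ.toSphere.prod (Measure.volumeIoiPow (n - 1))) := by
    rw [hdim] at hmp
    rw [← hmp.integrable_comp_emb hme]
    have : (G ∘ homeomorphUnitSphereProd _) =
        g ∘ (Subtype.val : ({0}ᶜ : Set (EuclideanSpace ℝ (Fin n))) → _) := funext hG
    rw [this, ← integrableOn_iff_comap_subtypeVal (by measurability)]
    exact hg.integrableOn
  -- normalizing the surface measure costs the factor `n vol(B)`, its total mass
  have key : ∀ s : ℝ, ∫ u : Metric.sphere (0 : EuclideanSpace ℝ (Fin n)) 1, g (s • u.1) ∂μ.toSphere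
      = (n * μ.real (Metric.ball 0 1)) * ∫ u, g (s • u) ∂(uniformSphere n) := by
    intro s
    rw [uniformSphere,
      (MeasurableEmbedding.subtype_coe Metric.isClosed_sphere.measurableSet).integral_map,
      integral_smul_measure]
    have h1 : μ.toSphere.real Set.univ = n * μ.real (Metric.ball 0 1) := by
      rw [Measure.toSphere_real_apply_univ, hdim]
    have h0 : μ.toSphere.real Set.univ ≠ 0 := by
      rw [Measure.real, ENNReal.toReal_ne_zero]
      exact ⟨by rw [Ne, Measure.measure_univ_eq_zero]; exact Measure.toSphere_ne_zero _,
        measure_ne_top _ _⟩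
    rw [← h1, ENNReal.toReal_inv, ← Measure.real, smul_eq_mul, mul_inv_cancel_left₀ h0]
  calc ∫ x, g x = ∫ x : ({0}ᶜ : Set (EuclideanSpace ℝ (Fin n))), g x.1 ∂(μ.comap (↑)) := by
        rw [integral_subtype_comap (measurableSet_singleton _).compl g, restrict_compl_singleton]
    _ = ∫ p, G p ∂(μ.toSphere.prod (Measure.volumeIoiPow (n - 1))) := by
        rw [hdim] at hmp
        rw [← hmp.integral_comp hme]
        exact integral_congr_ae (Filter.Eventually.of_forall fun x => (hG x).symm)
    _ = ∫ s : Set.Ioi (0 : ℝ), (n * μ.real (Metric.ball 0 1)) *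
          ∫ u, g ((s : ℝ) • u) ∂(uniformSphere n) ∂(Measure.volumeIoiPow (n - 1)) := by
        rw [integral_prod_symm _ hGint]
        exact integral_congr_ae (Filter.Eventually.of_forall fun s => key s)
    _ = _ := by
        rw [integral_const_mul]
        congr 1
        simp only [Measure.volumeIoiPow, ENNReal.ofReal]
        rw [integral_withDensity_eq_integral_smul (by fun_prop),
          integral_subtype_comap measurableSet_Ioi fun a : ℝ ↦
            Real.toNNReal (a ^ (n - 1)) • ∫ u, g (a • u) ∂(uniformSphere n)]
        refine setIntegral_congr_fun measurableSet_Ioi fun x hx ↦ ?_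
        simp only [NNReal.smul_def, Real.coe_toNNReal _ (pow_nonneg (le_of_lt hx) _), smul_eq_mul]

lemma integral_uniformBall (h : EuclideanSpace ℝ (Fin n) → ℝ) :
    ∫ x, h x ∂(uniformBall n) = (volume.real (Metric.ball (0 : EuclideanSpace ℝ (Fin n)) 1))⁻¹ *
      ∫ x in Metric.ball 0 1, h x := by
  rw [uniformBall, integral_smul_measure, ENNReal.toReal_inv, smul_eq_mul, Measure.real]

/-- The uniform ball as a radial mixture of uniform spheres. -/
lemma integral_uniformBall_polar (hn : 0 < n) {h : EuclideanSpace ℝ (Fin n) → ℝ}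
    (hh : Continuous h) :
    ∫ x, h x ∂(uniformBall n) =
      n * ∫ s in (0 : ℝ)..1, s ^ (n - 1) * ∫ u, h (s • u) ∂(uniformSphere n) := by
  have hb : volume.real (Metric.ball (0 : EuclideanSpace ℝ (Fin n)) 1) ≠ 0 :=
    ENNReal.toReal_ne_zero.2
      ⟨(Metric.measure_ball_pos _ _ one_pos).ne', measure_ball_lt_top.ne⟩
  have hint : Integrable ((Metric.ball (0 : EuclideanSpace ℝ (Fin n)) 1).indicator h) := by
    rw [integrable_indicator_iff Metric.isOpen_ball.measurableSet]
    exact (hh.continuousOn.integrableOn_compact (isCompact_closedBall _ _)).mono_set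
      Metric.ball_subset_closedBall
  rw [integral_uniformBall, ← integral_indicator Metric.isOpen_ball.measurableSet,
    integral_polar hn hint, ← mul_assoc, mul_comm (n : ℝ), inv_mul_cancel_left₀ hb,
    intervalIntegral.integral_of_le zero_le_one, ← integral_Ioc_eq_integral_Ioo.symm]
  congr 1
  rw [← integral_indicator measurableSet_Ioi, ← integral_indicator measurableSet_Ioo]
  congr 1
  ext s
  by_cases hs : 0 < s
  · have : ∫ u, (Metric.ball (0 : EuclideanSpace ℝ (Fin n)) 1).indicator h (s • u)
        ∂(uniformSphere n) = ∫ u, (Set.Iio (1 : ℝ)).indicator (fun _ => h (s • u)) s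
        ∂(uniformSphere n) := by
      refine integral_congr_ae ?_
      filter_upwards [ae_norm_eq_one_uniformSphere n] with u hu
      simp [Set.indicator, norm_smul, hu, abs_of_pos hs]
    rw [Set.indicator_of_mem (Set.mem_Ioi.2 hs), this]
    by_cases h1 : s < 1 <;> simp [hs, h1, Set.indicator]
  · simp [hs, Set.indicator]

/-! ### The divergence theorem on the unit ball -/

lemma continuous_integral_uniformSphere_smul (hn : 0 < n)
    {q : ℝ → EuclideanSpace ℝ (Fin n) → ℝ} (hq : Continuous q.uncurry) :
    Continuous fun s : ℝ => ∫ u, q s u ∂(uniformSphere n) := by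
  have := isProbabilityMeasure_uniformSphere hn
  have h := continuous_parametric_integral_of_continuous (μ := uniformSphere n) hq
    (isCompact_sphere (0 : EuclideanSpace ℝ (Fin n)) 1)
  rwa [Measure.restrict_eq_self_of_ae_mem] at h
  filter_upwards [ae_norm_eq_one_uniformSphere n] with u hu
  simpa using hu

lemma setIntegral_Ioi_eq_of_eqOn {a b : ℝ → ℝ} {r : ℝ} (hr : 0 ≤ r)
    (h1 : ∀ s, 0 < s → s < r → a s = b s) (h2 : ∀ s, r ≤ s → a s = 0) :
    ∫ s in Set.Ioi (0 : ℝ), a s = ∫ s in (0 : ℝ)..r, b s := by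
  rw [intervalIntegral.integral_of_le hr, integral_Ioc_eq_integral_Ioo,
    ← integral_indicator measurableSet_Ioi, ← integral_indicator measurableSet_Ioo]
  congr 1
  ext s
  by_cases hs : 0 < s
  · by_cases hs' : s < r
    · simp [Set.indicator, hs, hs', h1]
    · simp [Set.indicator, hs, hs', h2 s (not_lt.1 hs')]
  · simp [Set.indicator, hs]

lemma hasFDerivAt_norm_euclidean {x : EuclideanSpace ℝ (Fin n)} (hx : x ≠ 0) :
    HasFDerivAt (fun x : EuclideanSpace ℝ (Fin n) => ‖x‖) (‖x‖⁻¹ • innerSL ℝ x) x := by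
  have h := (hasStrictFDerivAt_norm_sq x).hasFDerivAt.sqrt (by simpa using hx)
  simp only [Real.sqrt_sq (norm_nonneg _)] at h
  rw [two_nsmul, ← two_smul ℝ, smul_smul] at h
  rwa [show 1 / (2 * ‖x‖) * 2 = ‖x‖⁻¹ by field_simp] at h

/-- Integrating `∂ᵥ k` against the tent function `(r - ‖x‖)₊` by parts, and passing to polar
coordinates. -/
lemma integral_tent_eq (hn : 0 < n) {k : EuclideanSpace ℝ (Fin n) → ℝ}
    (hk : ContDiff ℝ 1 k) (hkc : HasCompactSupport k) (v : EuclideanSpace ℝ (Fin n)) {r : ℝ}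
    (hr : 0 < r) :
    ∫ s in (0 : ℝ)..r, (r - s) * (s ^ (n - 1) * ∫ u, fderiv ℝ k (s • u) v ∂(uniformSphere n)) =
      ∫ s in (0 : ℝ)..r, s ^ (n - 1) * ∫ u, inner ℝ v u * k (s • u) ∂(uniformSphere n) := by
  have : NeZero n := ⟨hn.ne'⟩
  obtain ⟨C, hC⟩ := hk.lipschitzWith_of_hasCompactSupport hkc one_ne_zero
  have hfd : Continuous fun x => fderiv ℝ k x v :=
    (hk.continuous_fderiv one_ne_zero).clm_apply continuous_const
  let g : EuclideanSpace ℝ (Fin n) → ℝ := fun x => max (r - ‖x‖) 0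
  have hgc : HasCompactSupport g := by
    refine HasCompactSupport.intro (isCompact_closedBall 0 r) fun x hx => ?_
    simp only [Metric.mem_closedBall, dist_zero_right, not_le] at hx
    exact max_eq_right (by linarith)
  have hgL : LipschitzWith 1 g := by
    have h1 : LipschitzWith 1 fun x : EuclideanSpace ℝ (Fin n) => r - ‖x‖ := by
      refine LipschitzWith.of_dist_le_mul fun x y => ?_
      simp only [NNReal.coe_one, one_mul, dist_eq_norm]
      rw [show r - ‖x‖ - (r - ‖y‖) = -(‖x‖ - ‖y‖) by ring, norm_neg]
      exact abs_norm_sub_norm_le x y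
    exact h1.max_const 0
  have ibp := LipschitzWith.integral_lineDeriv_mul_eq
    (μ := (volume : Measure (EuclideanSpace ℝ (Fin n)))) hC hgL hgc v
  have hL : ∫ x, lineDeriv ℝ k x v * g x = ∫ x, fderiv ℝ k x v * g x := by
    congr 1; ext x
    rw [(hk.differentiable one_ne_zero x).lineDeriv_eq_fderiv]
  let q : EuclideanSpace ℝ (Fin n) → ℝ :=
    (Metric.ball 0 r).indicator fun x => ‖x‖⁻¹ * inner ℝ v x * k x
  have hR : ∫ x, lineDeriv ℝ g x (-v) * k x = ∫ x, q x := by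
    refine integral_congr_ae ?_
    -- the tent function is differentiable off the origin and the sphere of radius `r`
    have hs : ∀ᵐ x : EuclideanSpace ℝ (Fin n), x ∉ Metric.sphere 0 r :=
      measure_eq_zero_iff_ae_notMem.1 (Measure.addHaar_sphere _ _ _)
    have h0 : ∀ᵐ x : EuclideanSpace ℝ (Fin n), x ∉ ({0} : Set (EuclideanSpace ℝ (Fin n))) :=
      measure_eq_zero_iff_ae_notMem.1 (measure_singleton _)
    filter_upwards [hs, h0] with x hxs hx0
    simp only [Metric.mem_sphere, dist_zero_right] at hxs
    simp only [Set.mem_singleton_iff] at hx0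
    rcases lt_or_gt_of_ne hxs with hlt | hgt
    · have he : g =ᶠ[nhds x] fun y => r - ‖y‖ := by
        filter_upwards [(continuous_norm.tendsto x).eventually (gt_mem_nhds hlt)] with y hy
        exact max_eq_left (by linarith)
      have hd := ((hasFDerivAt_norm_euclidean hx0).const_sub r).congr_of_eventuallyEq he
      rw [(hd.hasLineDerivAt (-v)).lineDeriv]
      simp [q, hlt, real_inner_comm]
    · have he : g =ᶠ[nhds x] fun y => 0 := by
        filter_upwards [(continuous_norm.tendsto x).eventually (lt_mem_nhds hgt)] with y hy
        exact max_eq_right (by linarith)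
      have hd := (hasFDerivAt_const (𝕜 := ℝ) (0 : ℝ) x).congr_of_eventuallyEq he
      rw [(hd.hasLineDerivAt (-v)).lineDeriv]
      simp [q, hgt.le]
  have hqi : Integrable q := by
    rw [integrable_indicator_iff Metric.isOpen_ball.measurableSet]
    obtain ⟨K, hK⟩ := hkc.exists_bound_of_continuous hk.continuous
    have hm : Measurable fun x : EuclideanSpace ℝ (Fin n) => ‖x‖⁻¹ * inner ℝ v x * k x := by
      have := hk.continuous.measurable
      fun_prop
    have : IsFiniteMeasure ((volume : Measure (EuclideanSpace ℝ (Fin n))).restrict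
      (Metric.ball 0 r)) := ⟨by simpa using measure_ball_lt_top⟩
    refine Integrable.of_bound hm.aestronglyMeasurable (‖v‖ * K) (Filter.Eventually.of_forall ?_)
    intro x
    rw [norm_mul]
    refine mul_le_mul ?_ (hK x) (norm_nonneg _) (norm_nonneg _)
    rw [norm_mul, norm_inv, norm_norm]
    calc ‖x‖⁻¹ * ‖inner ℝ v x‖ ≤ ‖x‖⁻¹ * (‖v‖ * ‖x‖) := by
          gcongr; exact norm_inner_le_norm v x
      _ ≤ ‖v‖ := by
          by_cases h : ‖x‖ = 0
          · simp [h]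
          · field_simp; rfl
  have hfi : Integrable fun x => fderiv ℝ k x v * g x :=
    (hfd.mul hgL.continuous).integrable_of_hasCompactSupport hgc.mul_left
  rw [hL, hR, integral_polar hn hfi, integral_polar hn hqi] at ibp
  have hb : (n * volume.real (Metric.ball (0 : EuclideanSpace ℝ (Fin n)) 1)) ≠ 0 :=
    mul_ne_zero (by exact_mod_cast hn.ne') (ENNReal.toReal_ne_zero.2
      ⟨(Metric.measure_ball_pos _ _ one_pos).ne', measure_ball_lt_top.ne⟩)
  have ibp := mul_left_cancel₀ hb ibp
  rw [setIntegral_Ioi_eq_of_eqOn hr.le (r := r)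
      (b := fun s => (r - s) * (s ^ (n - 1) * ∫ u, fderiv ℝ k (s • u) v ∂(uniformSphere n))),
    setIntegral_Ioi_eq_of_eqOn hr.le (r := r)
      (b := fun s => s ^ (n - 1) * ∫ u, inner ℝ v u * k (s • u) ∂(uniformSphere n))] at ibp
  · exact ibp
  · intro s hs hsr
    congr 1
    refine integral_congr_ae ?_
    filter_upwards [ae_norm_eq_one_uniformSphere n] with u hu
    have hs' := hs.ne'
    simp only [q]
    rw [Set.indicator_of_mem (by simpa [norm_smul, hu, abs_of_pos hs] using hsr), norm_smul, hu,
      Real.norm_eq_abs, abs_of_pos hs, mul_one, inner_smul_right, inv_mul_cancel_left₀ hs']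
  · intro s hs
    refine mul_eq_zero_of_right _ (integral_eq_zero_of_ae ?_)
    filter_upwards [ae_norm_eq_one_uniformSphere n] with u hu
    exact Set.indicator_of_notMem (by simpa [norm_smul, hu, abs_of_pos (hr.trans_le hs)] using hs) _
  · intro s hs hsr
    rw [mul_left_comm (r - s), ← integral_const_mul (r - s)]
    congr 1
    refine integral_congr_ae ?_
    filter_upwards [ae_norm_eq_one_uniformSphere n] with u hu
    have : g (s • u) = r - s := by
      simp only [g, norm_smul, hu, Real.norm_eq_abs, abs_of_pos hs, mul_one]
      exact max_eq_left (by linarith)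
    rw [this, mul_comm]
  · intro s hs
    refine mul_eq_zero_of_right _ (integral_eq_zero_of_ae ?_)
    filter_upwards [ae_norm_eq_one_uniformSphere n] with u hu
    have : g (s • u) = 0 := by
      simp only [g, norm_smul, hu, Real.norm_eq_abs, abs_of_pos (hr.trans_le hs), mul_one]
      exact max_eq_right (by linarith)
    simp [this]

/-- The case of compact support, which makes `k` Lipschitz. With
`H(s) = s^(n-1) E[∂ᵥ k(sU)]` and `G(s) = s^(n-1) E[⟨v, U⟩ k(sU)]`, differentiating
`∫₀ʳ (r - s) H(s) ds = ∫₀ʳ G(s) ds` at `r = 1` gives `∫₀¹ H = G(1)`. -/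
lemma divergence_of_hasCompactSupport (hn : 0 < n) {k : EuclideanSpace ℝ (Fin n) → ℝ}
    (hk : ContDiff ℝ 1 k) (hkc : HasCompactSupport k) (v : EuclideanSpace ℝ (Fin n)) :
    ∫ x, fderiv ℝ k x v ∂(uniformBall n) = n * ∫ u, inner ℝ v u * k u ∂(uniformSphere n) := by
  have hfd : Continuous fun x => fderiv ℝ k x v :=
    (hk.continuous_fderiv one_ne_zero).clm_apply continuous_const
  rw [integral_uniformBall_polar hn hfd]
  congr 1
  set H : ℝ → ℝ := fun s => s ^ (n - 1) * ∫ u, fderiv ℝ k (s • u) v ∂(uniformSphere n) with hH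
  set G : ℝ → ℝ := fun s => s ^ (n - 1) * ∫ u, inner ℝ v u * k (s • u) ∂(uniformSphere n) with hG
  have hHc : Continuous H := (continuous_pow _).mul (continuous_integral_uniformSphere_smul hn
    (hfd.comp (by fun_prop : Continuous fun p : ℝ × EuclideanSpace ℝ (Fin n) => p.1 • p.2)))
  have hGc : Continuous G := by
    have := hk.continuous
    refine (continuous_pow _).mul (continuous_integral_uniformSphere_smul hn ?_)
    simp only [Function.uncurry_def]
    fun_prop
  have d1 : HasDerivAt (fun r => ∫ s in (0 : ℝ)..r, G s) (G 1) 1 :=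
    intervalIntegral.integral_hasDerivAt_right (hGc.intervalIntegrable _ _)
      (hGc.stronglyMeasurableAtFilter _ _) hGc.continuousAt
  have d2 : HasDerivAt (fun r => ∫ s in (0 : ℝ)..r, H s) (H 1) 1 :=
    intervalIntegral.integral_hasDerivAt_right (hHc.intervalIntegrable _ _)
      (hHc.stronglyMeasurableAtFilter _ _) hHc.continuousAt
  have hsH : Continuous fun s => s * H s := continuous_id.mul hHc
  have d3 : HasDerivAt (fun r => ∫ s in (0 : ℝ)..r, s * H s) (1 * H 1) 1 :=
    intervalIntegral.integral_hasDerivAt_right (hsH.intervalIntegrable _ _)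
      (hsH.stronglyMeasurableAtFilter _ _) hsH.continuousAt
  have d4 := ((hasDerivAt_id (1 : ℝ)).mul d2).sub d3
  have he : (fun r => ∫ s in (0 : ℝ)..r, G s) =ᶠ[nhds 1]
      ((id * fun r => ∫ s in (0 : ℝ)..r, H s) - fun r => ∫ s in (0 : ℝ)..r, s * H s) := by
    filter_upwards [lt_mem_nhds (zero_lt_one' ℝ)] with r hr
    rw [hG, ← integral_tent_eq hn hk hkc v hr]
    simp only [Pi.sub_apply, Pi.mul_apply, id]
    have hrH : Continuous fun s => r * H s := continuous_const.mul hHc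
    rw [← intervalIntegral.integral_const_mul, ← intervalIntegral.integral_sub
      (hrH.intervalIntegrable _ _) (hsH.intervalIntegrable _ _)]
    simp only [sub_mul, hH]
  have := (d4.congr_of_eventuallyEq he).unique d1
  simpa [hG] using this

/-- The divergence theorem on the unit ball, for the vector field `k v`: a cutoff equal to `1` near
the closed ball reduces it to compact support. -/
lemma divergence_uniformBall (hn : 0 < n) {k : EuclideanSpace ℝ (Fin n) → ℝ}
    (hk : ContDiff ℝ 1 k) (v : EuclideanSpace ℝ (Fin n)) :
    ∫ x, fderiv ℝ k x v ∂(uniformBall n) = n * ∫ u, inner ℝ v u * k u ∂(uniformSphere n) := by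
  let χ : ContDiffBump (0 : EuclideanSpace ℝ (Fin n)) := ⟨2, 3, by norm_num, by norm_num⟩
  have h1 : ∀ x : EuclideanSpace ℝ (Fin n), ‖x‖ ≤ 1 → (fun y => χ y * k y) =ᶠ[nhds x] k := by
    intro x hx
    have hx2 : x ∈ Metric.ball (0 : EuclideanSpace ℝ (Fin n)) 2 := by
      simp only [Metric.mem_ball, dist_zero_right]; linarith
    filter_upwards [Metric.isOpen_ball.mem_nhds hx2] with y hy
    rw [χ.one_of_mem_closedBall (Metric.ball_subset_closedBall hy), one_mul]
  have h := divergence_of_hasCompactSupport hn (χ.contDiff.mul hk) χ.hasCompactSupport.mul_right v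
  convert h using 1
  · refine integral_congr_ae ?_
    filter_upwards [ae_norm_lt_one_uniformBall n] with x hx
    rw [(h1 x hx.le).fderiv_eq]
  · congr 1
    refine integral_congr_ae ?_
    filter_upwards [ae_norm_eq_one_uniformSphere n] with x hx
    exact congrArg _ (h1 x hx.le).eq_of_nhds.symm

/-! ### The characteristic function of the uniform distribution on the ball -/

lemma integral_inner_pow_uniformBall_eq_uniformSphere (hn : 0 < n)
    (t : EuclideanSpace ℝ (Fin n)) (m : ℕ) :
    ∫ x, inner ℝ t x ^ m ∂(uniformBall n) =
      n / (n + m) * ∫ u, inner ℝ t u ^ m ∂(uniformSphere n) := by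
  rw [integral_uniformBall_polar hn (by fun_prop)]
  have h : ∀ s : ℝ, s ^ (n - 1) * ∫ u, inner ℝ t (s • u) ^ m ∂(uniformSphere n) =
      s ^ (n - 1 + m) * ∫ u, inner ℝ t u ^ m ∂(uniformSphere n) := by
    intro s
    simp only [inner_smul_right, mul_pow]
    rw [integral_const_mul, pow_add, mul_assoc]
  simp only [h]
  rw [intervalIntegral.integral_mul_const, integral_pow]
  have : ((n - 1 + m : ℕ) : ℝ) + 1 = n + m := by
    rw [← Nat.cast_succ, ← Nat.cast_add]; congr 1; omega
  rw [this]
  simp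
  ring

/-- The recursion for the even moments: the divergence theorem for the field `⟨t, x⟩^(2k+1) t`. -/
lemma integral_inner_pow_uniformBall_succ (hn : 0 < n) (t : EuclideanSpace ℝ (Fin n)) (k : ℕ) :
    ∫ x, inner ℝ t x ^ (2 * (k + 1)) ∂(uniformBall n) =
      (2 * k + 1) * ‖t‖ ^ 2 / (n + 2 * (k + 1)) * ∫ x, inner ℝ t x ^ (2 * k) ∂(uniformBall n) := by
  have hd := divergence_uniformBall hn (k := fun x => inner ℝ t x ^ (2 * k + 1))
    (((innerSL ℝ t).contDiff).pow _) t
  have h1 : ∀ x : EuclideanSpace ℝ (Fin n),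
      fderiv ℝ (fun x => inner ℝ t x ^ (2 * k + 1)) x t =
        ((2 * k + 1) * ‖t‖ ^ 2) * inner ℝ t x ^ (2 * k) := by
    intro x
    have := ((innerSL ℝ t).hasFDerivAt (x := x)).pow (2 * k + 1)
    simp only [innerSL_apply_apply] at this
    rw [this.fderiv]
    simp
    ring
  simp only [h1, integral_const_mul] at hd
  rw [integral_inner_pow_uniformBall_eq_uniformSphere hn, div_mul_eq_mul_div, div_mul_eq_mul_div,
    hd]
  push_cast
  congr 2
  congr 1
  ext u
  ring

/-- The even moments of a linear form under the uniform distribution on the ball. -/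
lemma integral_inner_pow_uniformBall (hn : 0 < n) (t : EuclideanSpace ℝ (Fin n)) (k : ℕ) :
    ∫ x, inner ℝ t x ^ (2 * k) ∂(uniformBall n) =
      (2 * k).factorial * ((‖t‖ ^ 2 / 4) ^ k / k.factorial) *
        (1 / (ascPochhammer ℝ k).eval ((n : ℝ) / 2 + 1)) := by
  induction k with
  | zero =>
    have := isProbabilityMeasure_uniformBall n
    simp
  | succ k ih =>
    rw [integral_inner_pow_uniformBall_succ hn, ih, ascPochhammer_succ_eval,
      show 2 * (k + 1) = 2 * k + 1 + 1 by ring, Nat.factorial_succ, Nat.factorial_succ,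
      Nat.factorial_succ]
    have h1 : 0 < (ascPochhammer ℝ k).eval ((n : ℝ) / 2 + 1) :=
      ascPochhammer_pos k _ (by positivity)
    have h2 : (n : ℝ) / 2 + 1 + k ≠ 0 := by positivity
    have h3 : (n : ℝ) + 2 * (k + 1) ≠ 0 := by positivity
    push_cast
    field_simp
    ring

/-- The cosine series, integrated term by term. -/
lemma integral_cos_uniformBall (hn : 0 < n) (t : EuclideanSpace ℝ (Fin n)) :
    ∫ x, Real.cos (inner ℝ t x) ∂(uniformBall n) = hyp0F1 ((n : ℝ) / 2 + 1) (-(‖t‖ ^ 2) / 4) := by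
  have := isProbabilityMeasure_uniformBall n
  have hsum : Summable fun k : ℕ => ‖t‖ ^ (2 * k) / ((2 * k).factorial : ℝ) :=
    (Real.hasSum_cosh ‖t‖).summable
  have hcos : ∀ x : EuclideanSpace ℝ (Fin n), HasSum
      (fun k : ℕ => (-1) ^ k * (inner ℝ t x : ℝ) ^ (2 * k) / ((2 * k).factorial : ℝ))
      (Real.cos (inner ℝ t x)) := fun x => Real.hasSum_cos _
  have hm : ∀ k : ℕ, AEStronglyMeasurable (fun x : EuclideanSpace ℝ (Fin n) =>
      (-1) ^ k * (inner ℝ t x : ℝ) ^ (2 * k) / ((2 * k).factorial : ℝ)) (uniformBall n) :=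
    fun k => Continuous.aestronglyMeasurable (by fun_prop)
  have hb : ∀ k : ℕ, ∀ᵐ x ∂(uniformBall n),
      ‖(-1) ^ k * (inner ℝ t x : ℝ) ^ (2 * k) / ((2 * k).factorial : ℝ)‖ ≤
        ‖t‖ ^ (2 * k) / ((2 * k).factorial : ℝ) := by
    intro k
    filter_upwards [ae_norm_lt_one_uniformBall n] with x hx
    rw [norm_div, norm_mul, norm_pow, norm_neg, norm_one, one_pow, one_mul, norm_natCast, norm_pow]
    refine div_le_div_of_nonneg_right (pow_le_pow_left₀ (norm_nonneg _) ?_ _) (Nat.cast_nonneg _)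
    exact (norm_inner_le_norm t x).trans (mul_le_of_le_one_right (norm_nonneg _) hx.le)
  have hs := hasSum_integral_of_dominated_convergence
    (fun (k : ℕ) _ => ‖t‖ ^ (2 * k) / ((2 * k).factorial : ℝ)) hm hb
    (Filter.Eventually.of_forall fun _ => hsum) (integrable_const _)
    (Filter.Eventually.of_forall hcos)
  rw [← hs.tsum_eq, hyp0F1]
  refine tsum_congr fun k => ?_
  rw [integral_div, integral_const_mul, integral_inner_pow_uniformBall hn,
    show -(‖t‖ ^ 2) / 4 = (-1) * (‖t‖ ^ 2 / 4) by ring, mul_pow]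
  have : ((2 * k).factorial : ℝ) ≠ 0 := by positivity
  rw [div_eq_iff this]
  ring

lemma integral_sin_uniformBall (t : EuclideanSpace ℝ (Fin n)) :
    ∫ x, Real.sin (inner ℝ t x) ∂(uniformBall n) = 0 := by
  rw [integral_uniformBall, ← integral_indicator Metric.isOpen_ball.measurableSet]
  refine mul_eq_zero_of_right _ ?_
  have h := integral_neg_eq_self ((Metric.ball (0 : EuclideanSpace ℝ (Fin n)) 1).indicator
    fun x => Real.sin (inner ℝ t x)) volume
  have h' : ∀ x, (Metric.ball (0 : EuclideanSpace ℝ (Fin n)) 1).indicator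
      (fun x => Real.sin (inner ℝ t x)) (-x) = - (Metric.ball (0 : EuclideanSpace ℝ (Fin n))
        1).indicator (fun x => Real.sin (inner ℝ t x)) x := by
    intro x
    simp only [Set.indicator, Metric.mem_ball, dist_zero_right, norm_neg, inner_neg_right,
      Real.sin_neg]
    split_ifs <;> simp
  simp only [h', integral_neg] at h
  linarith

/-- The characteristic function of the uniform distribution on the unit ball. -/
lemma charFun_uniformBall (hn : 0 < n) (t : EuclideanSpace ℝ (Fin n)) :
    charFun (uniformBall n) t = (hyp0F1 ((n : ℝ) / 2 + 1) (-(‖t‖ ^ 2) / 4) : ℝ) := by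
  rw [charFun_apply, ← integral_cos_uniformBall hn]
  have hc : Integrable (fun x => ((Real.cos (inner ℝ t x) : ℝ) : ℂ)) (uniformBall n) :=
    (integrable_uniformBall_of_continuous
      (Real.continuous_cos.comp (by fun_prop))).ofReal
  have hs : Integrable (fun x => ((Real.sin (inner ℝ t x) : ℝ) : ℂ) * Complex.I) (uniformBall n) :=
    (integrable_uniformBall_of_continuous
      (Real.continuous_sin.comp (by fun_prop))).ofReal.mul_const _
  have : ∀ x : EuclideanSpace ℝ (Fin n), Complex.exp ((inner ℝ x t : ℝ) * Complex.I) =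
      ((Real.cos (inner ℝ t x) : ℝ) : ℂ) + ((Real.sin (inner ℝ t x) : ℝ) : ℂ) * Complex.I := by
    intro x
    rw [Complex.exp_mul_I, real_inner_comm, Complex.ofReal_cos, Complex.ofReal_sin]
  simp only [this]
  rw [integral_add hc hs, integral_mul_const, integral_complex_ofReal, integral_complex_ofReal,
    integral_sin_uniformBall]
  simp

/-! ### Radial mixtures and the Stein-type identity -/

/-- The size-biased law `r² ρ(dr) / ∫ r² dρ`. -/
noncomputable def sizeBiased (ρ : Measure ℝ) : Measure ℝ :=
  ρ.withDensity fun r => ENNReal.ofReal (r ^ 2 / ∫ r, r ^ 2 ∂ρ)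

/-- The spherical law of `R U`, where `R ∼ ρ` and `U` is uniform on the unit sphere and independent
of `R`. -/
noncomputable def sphereMixture (n : ℕ) (ρ : Measure ℝ) : Measure (EuclideanSpace ℝ (Fin n)) :=
  (ρ.prod (uniformSphere n)).map fun p => p.1 • p.2

/-- The spherical law with generator `psi1 n ρ`: a uniform point of the unit ball, multiplied by an
independent factor with the size-biased law. -/
noncomputable def ballMixture (n : ℕ) (ρ : Measure ℝ) : Measure (EuclideanSpace ℝ (Fin n)) :=
  ((sizeBiased ρ).prod (uniformBall n)).map fun p => p.1 • p.2

lemma isProbabilityMeasure_sphereMixture (hn : 0 < n) (ρ : Measure ℝ) [IsProbabilityMeasure ρ] :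
    IsProbabilityMeasure (sphereMixture n ρ) := by
  have := isProbabilityMeasure_uniformSphere hn
  exact Measure.isProbabilityMeasure_map (by fun_prop)

lemma isProbabilityMeasure_sizeBiased {ρ : Measure ℝ} (hρ : Integrable (fun r => r ^ 2) ρ)
    (hM : 0 < ∫ r, r ^ 2 ∂ρ) : IsProbabilityMeasure (sizeBiased ρ) := by
  refine ⟨?_⟩
  rw [sizeBiased, withDensity_apply _ MeasurableSet.univ, Measure.restrict_univ,
    ← ofReal_integral_eq_lintegral_ofReal (hρ.div_const _)
      (Filter.Eventually.of_forall fun r => by positivity), integral_div, div_self hM.ne']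
  simp

lemma isProbabilityMeasure_ballMixture {ρ : Measure ℝ} (hρ : Integrable (fun r => r ^ 2) ρ)
    (hM : 0 < ∫ r, r ^ 2 ∂ρ) : IsProbabilityMeasure (ballMixture n ρ) := by
  have := isProbabilityMeasure_sizeBiased hρ hM
  have := isProbabilityMeasure_uniformBall n
  exact Measure.isProbabilityMeasure_map (by fun_prop)

lemma integral_sizeBiased {G : Type*} [NormedAddCommGroup G] [NormedSpace ℝ G] (ρ : Measure ℝ)
    (h : ℝ → G) :
    ∫ r, h r ∂(sizeBiased ρ) = ∫ r, (r ^ 2 / ∫ r, r ^ 2 ∂ρ) • h r ∂ρ := by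
  have hM : 0 ≤ ∫ r, r ^ 2 ∂ρ := integral_nonneg fun r => by positivity
  rw [sizeBiased, integral_withDensity_eq_integral_toReal_smul (by fun_prop)
    (Filter.Eventually.of_forall fun _ => ENNReal.ofReal_lt_top)]
  refine integral_congr_ae (Filter.Eventually.of_forall fun r => ?_)
  simp only
  rw [ENNReal.toReal_ofReal (by positivity)]

lemma charFun_ballMixture (hn : 0 < n) {ρ : Measure ℝ} (hρ : Integrable (fun r => r ^ 2) ρ)
    (hM : 0 < ∫ r, r ^ 2 ∂ρ) (t : EuclideanSpace ℝ (Fin n)) :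
    charFun (ballMixture n ρ) t = (psi1 n ρ (‖t‖ ^ 2) : ℝ) := by
  have := isProbabilityMeasure_sizeBiased hρ hM
  have := isProbabilityMeasure_uniformBall n
  have hi : Integrable (fun p : ℝ × EuclideanSpace ℝ (Fin n) =>
      Complex.exp ((inner ℝ (p.1 • p.2) t : ℝ) * Complex.I))
      ((sizeBiased ρ).prod (uniformBall n)) := by
    refine Integrable.of_bound (Continuous.aestronglyMeasurable (by fun_prop)) 1
      (Filter.Eventually.of_forall fun p => ?_)
    rw [Complex.norm_exp_ofReal_mul_I]
  rw [charFun_apply, ballMixture, integral_map (by fun_prop)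
    (Continuous.aestronglyMeasurable (by fun_prop)), integral_prod _ hi]
  have h : ∀ r : ℝ, ∫ x, Complex.exp ((inner ℝ (r • x) t : ℝ) * Complex.I) ∂(uniformBall n) =
      (hyp0F1 ((n : ℝ) / 2 + 1) (-(r ^ 2 * ‖t‖ ^ 2) / 4) : ℝ) := by
    intro r
    have := charFun_uniformBall hn (r • t)
    rw [charFun_apply, norm_smul, mul_pow, Real.norm_eq_abs, sq_abs] at this
    rw [← this]
    simp only [real_inner_smul_left, inner_smul_right]
  simp only [h]
  rw [integral_complex_ofReal, integral_sizeBiased, psi1, ← integral_const_mul]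
  congr 2
  ext r
  rw [smul_eq_mul]
  ring

lemma ballMixture_absolutelyContinuous (ρ : Measure ℝ) [IsProbabilityMeasure ρ] :
    ballMixture n ρ ≪ volume := by
  have := isProbabilityMeasure_uniformBall n
  refine Measure.AbsolutelyContinuous.mk fun s hs h0 => ?_
  have : SFinite (sizeBiased ρ) := by unfold sizeBiased; infer_instance
  have hm : Measurable fun p : ℝ × EuclideanSpace ℝ (Fin n) => p.1 • p.2 := by fun_prop
  rw [ballMixture, Measure.map_apply hm hs, Measure.prod_apply (hm hs), lintegral_eq_zero_iff
    (measurable_measure_prodMk_left (hm hs))]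
  -- the size-biased law does not charge the origin
  have hr : ∀ᵐ r ∂(sizeBiased ρ), r ≠ 0 := by
    rw [sizeBiased, ae_withDensity_iff (by fun_prop)]
    refine Filter.Eventually.of_forall fun r hr h => hr ?_
    simp [h]
  filter_upwards [hr] with r hr
  refine uniformBall_absolutelyContinuous n ?_
  have := Measure.addHaar_preimage_smul (volume : Measure (EuclideanSpace ℝ (Fin n))) hr s
  rw [h0, mul_zero] at this
  exact this

/-- A Stein-type identity, `E⟨Z, F(Z)⟩ = (E(R²) / n) E[div F(Z₁)]`: on each sphere of radius `r`
it is the divergence theorem, whose factor `r²` turns the law of the radius into the size-biased one. -/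
lemma integral_sphereMixture_sum_eq (hn : 0 < n) {ρ : Measure ℝ} [IsProbabilityMeasure ρ]
    (hρ : Integrable (fun r => r ^ 2) ρ) (hM : 0 < ∫ r, r ^ 2 ∂ρ)
    {F : Fin n → EuclideanSpace ℝ (Fin n) → ℝ} (hF : ∀ i, ContDiff ℝ 1 (F i))
    (h0 : Integrable (fun z => ∑ i, z i * F i z) (sphereMixture n ρ))
    (h1 : Integrable (fun z => ∑ i, fderiv ℝ (F i) z (EuclideanSpace.single i 1))
      (ballMixture n ρ)) :
    ∫ z, ∑ i, z i * F i z ∂(sphereMixture n ρ) = (∫ r, r ^ 2 ∂ρ) / n *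
      ∫ z, ∑ i, fderiv ℝ (F i) z (EuclideanSpace.single i 1) ∂(ballMixture n ρ) := by
  have := isProbabilityMeasure_sizeBiased hρ hM
  have := isProbabilityMeasure_uniformBall n
  have := isProbabilityMeasure_uniformSphere hn
  have hn0 : (n : ℝ) ≠ 0 := by exact_mod_cast hn.ne'
  have hFc : ∀ i, Continuous (F i) := fun i => (hF i).continuous
  have hdc : ∀ i, Continuous fun z => fderiv ℝ (F i) z (EuclideanSpace.single i 1) :=
    fun i => ((hF i).continuous_fderiv one_ne_zero).clm_apply continuous_const
  have hm : AEMeasurable (fun p : ℝ × EuclideanSpace ℝ (Fin n) => p.1 • p.2)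
    (ρ.prod (uniformSphere n)) := by fun_prop
  have hm' : AEMeasurable (fun p : ℝ × EuclideanSpace ℝ (Fin n) => p.1 • p.2)
    ((sizeBiased ρ).prod (uniformBall n)) := by fun_prop
  rw [sphereMixture] at h0 ⊢
  rw [ballMixture] at h1 ⊢
  have h0' := (integrable_map_measure h0.1 hm).1 h0
  have h1' := (integrable_map_measure h1.1 hm').1 h1
  simp only [Function.comp_def] at h0' h1'
  rw [integral_map hm h0.1, integral_prod _ h0', integral_map hm' h1.1, integral_prod _ h1',
    integral_sizeBiased, ← integral_const_mul]
  refine integral_congr_ae (Filter.Eventually.of_forall fun r => ?_)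
  simp only
  have hk : ∀ i, ContDiff ℝ 1 fun x => F i (r • x) := fun i => (hF i).comp (contDiff_const_smul r)
  have hd : ∀ i x, fderiv ℝ (fun x => F i (r • x)) x (EuclideanSpace.single i 1) =
      r * fderiv ℝ (F i) (r • x) (EuclideanSpace.single i 1) := by
    intro i x
    have h := (((hF i).differentiable one_ne_zero (r • x)).hasFDerivAt).comp x
      ((hasFDerivAt_id x).const_smul r)
    rw [HasFDerivAt.fderiv (f := fun x => F i (r • x)) h]
    simp
  have key : ∀ i, ∫ u, (r • u) i * F i (r • u) ∂(uniformSphere n) =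
      r ^ 2 / n * ∫ x, fderiv ℝ (F i) (r • x) (EuclideanSpace.single i 1) ∂(uniformBall n) := by
    intro i
    have h := divergence_uniformBall hn (hk i) (EuclideanSpace.single i 1)
    simp only [hd] at h
    rw [integral_const_mul] at h
    simp only [EuclideanSpace.inner_single_left, map_one, one_mul] at h
    rw [pow_two, mul_div_right_comm, mul_assoc, h, div_mul_eq_mul_div, mul_left_comm,
      mul_div_cancel_left₀ _ hn0, ← integral_const_mul]
    simp [mul_assoc]
  have hdr : ∀ i, Continuous fun x => fderiv ℝ (F i) (r • x) (EuclideanSpace.single i 1) :=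
    fun i => (hdc i).comp (by fun_prop : Continuous fun x : EuclideanSpace ℝ (Fin n) => r • x)
  rw [integral_finsetSum _ fun i _ => integrable_uniformSphere_of_continuous hn
      (by have := hFc i; fun_prop),
    integral_finsetSum _ fun i _ => integrable_uniformBall_of_continuous (hdr i),
    Finset.sum_congr rfl fun i _ => key i, ← Finset.mul_sum, smul_eq_mul, ← mul_assoc]
  congr 1
  field_simp

lemma integrable_one_add_norm_sq_sphereMixture (hn : 0 < n) {ρ : Measure ℝ} [IsProbabilityMeasure ρ]
    (hρ : Integrable (fun r => r ^ 2) ρ) :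
    Integrable (fun z => (1 + ‖z‖) ^ 2) (sphereMixture n ρ) := by
  have := isProbabilityMeasure_uniformSphere hn
  rw [sphereMixture, integrable_map_measure (Continuous.aestronglyMeasurable (by fun_prop))
    (by fun_prop)]
  have h : Integrable (fun p : ℝ × EuclideanSpace ℝ (Fin n) => 2 + 2 * p.1 ^ 2)
      (ρ.prod (uniformSphere n)) :=
    (integrable_const _).add ((hρ.comp_fst _).const_mul 2)
  refine h.mono' (Continuous.aestronglyMeasurable (by fun_prop)) ?_
  have hu : ∀ᵐ p ∂(ρ.prod (uniformSphere n)), ‖p.2‖ = 1 :=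
    Measure.quasiMeasurePreserving_snd.ae (ae_norm_eq_one_uniformSphere n)
  filter_upwards [hu] with p hp
  simp only [Function.comp, norm_smul, hp, Real.norm_eq_abs, mul_one]
  rw [abs_of_nonneg (by positivity), ← sq_abs p.1]
  nlinarith [sq_nonneg (1 - |p.1|)]

/-! ### Simultaneous diagonalization and elliptical laws as affine images of spherical laws -/

/-- The affine map `z ↦ m + ∑ᵢ sᵢ zᵢ cᵢ`. -/
noncomputable def diagAffine (c : Fin n → EuclideanSpace ℝ (Fin n))
    (m : EuclideanSpace ℝ (Fin n)) (s : Fin n → ℝ) (z : EuclideanSpace ℝ (Fin n)) :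
    EuclideanSpace ℝ (Fin n) :=
  m + ∑ i, (s i * z i) • c i

/-- Two positive definite matrices are simultaneously diagonalized by a congruence. -/
lemma exists_simultaneous_diagonalization {A Sx Sy : Matrix (Fin n) (Fin n) ℝ}
    (hSx : Sx.PosDef) (hSy : Sy.PosDef) (hA : A.transpose * A = Sx) :
    ∃ (C : Matrix (Fin n) (Fin n) ℝ) (d : Fin n → ℝ), IsUnit C ∧ (∀ i, 0 < d i) ∧
      Sx = C * C.transpose ∧ Sy = C * Matrix.diagonal d * C.transpose := by
  have hdet : IsUnit A.det := by
    have h := hSx.det_pos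
    rw [← hA, Matrix.det_mul, Matrix.det_transpose] at h
    exact isUnit_iff_ne_zero.2 fun h0 => by simp [h0] at h
  have hAu : IsUnit A := (Matrix.isUnit_iff_isUnit_det A).2 hdet
  have hA2 : A⁻¹ * A = 1 := Matrix.nonsing_inv_mul A hdet
  have hM : ((A⁻¹).conjTranspose * Sy * A⁻¹).PosDef := by
    refine hSy.conjTranspose_mul_mul_same ?_
    exact Matrix.mulVec_injective_of_isUnit ((Matrix.isUnit_nonsing_inv_iff).2 hAu)
  rw [Matrix.conjTranspose_eq_transpose_of_trivial] at hM
  set M := (A⁻¹).transpose * Sy * A⁻¹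
  let V : Matrix (Fin n) (Fin n) ℝ := hM.isHermitian.eigenvectorUnitary
  have hV1 : V * V.transpose = 1 := by
    have := Matrix.mem_unitaryGroup_iff.1 hM.isHermitian.eigenvectorUnitary.2
    rwa [Matrix.star_eq_conjTranspose, Matrix.conjTranspose_eq_transpose_of_trivial] at this
  have hspec : M = V * Matrix.diagonal hM.isHermitian.eigenvalues * V.transpose := by
    have := hM.isHermitian.spectral_theorem
    rw [Unitary.conjStarAlgAut_apply, Matrix.star_eq_conjTranspose,
      Matrix.conjTranspose_eq_transpose_of_trivial] at this
    exact this
  refine ⟨A.transpose * V, hM.isHermitian.eigenvalues, ?_, hM.eigenvalues_pos, ?_, ?_⟩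
  · exact ((Matrix.isUnit_transpose A).2 hAu).mul (IsUnit.of_mul_eq_one _ hV1)
  · rw [Matrix.transpose_mul, Matrix.transpose_transpose, Matrix.mul_assoc, ← Matrix.mul_assoc V,
      hV1, Matrix.one_mul, hA]
  · calc Sy = (A⁻¹ * A).transpose * Sy * (A⁻¹ * A) := by simp [hA2]
      _ = A.transpose * M * A := by
        simp only [M, Matrix.transpose_mul, Matrix.mul_assoc]
      _ = A.transpose * (V * Matrix.diagonal hM.isHermitian.eigenvalues * V.transpose) * A :=
        congrArg (fun N => A.transpose * N * A) hspec
      _ = _ := by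
        simp only [Matrix.transpose_mul, Matrix.mul_assoc, Matrix.transpose_transpose]

lemma inner_mulVec_of_eq {S C : Matrix (Fin n) (Fin n) ℝ} {d : Fin n → ℝ}
    (hS : S = C * Matrix.diagonal d * C.transpose) (t : EuclideanSpace ℝ (Fin n)) :
    inner ℝ t (mulVec S t) = ∑ i, d i * (inner ℝ t (WithLp.toLp 2 (C.col i))) ^ 2 := by
  have h : ∀ i, inner ℝ t (WithLp.toLp 2 (C.col i)) = C.transpose.mulVec t.ofLp i := by
    intro i
    simp [PiLp.inner_apply, Matrix.mulVec, dotProduct]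
  have h2 : inner ℝ t (mulVec S t) = t.ofLp ⬝ᵥ S.mulVec t.ofLp := by
    simp [PiLp.inner_apply, mulVec, dotProduct, mul_comm]
  rw [h2, hS, ← Matrix.mulVec_mulVec, ← Matrix.mulVec_mulVec, Matrix.dotProduct_mulVec,
    ← Matrix.mulVec_transpose]
  simp only [h, dotProduct, Matrix.mulVec_diagonal]
  exact Finset.sum_congr rfl fun i _ => by ring

lemma inner_diagAffine (c : Fin n → EuclideanSpace ℝ (Fin n)) (m : EuclideanSpace ℝ (Fin n))
    (s : Fin n → ℝ) (z t : EuclideanSpace ℝ (Fin n)) :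
    inner ℝ (diagAffine c m s z) t =
      inner ℝ t m + inner ℝ z (WithLp.toLp 2 fun i => s i * inner ℝ t (c i)) := by
  rw [diagAffine, inner_add_left, sum_inner, real_inner_comm]
  congr 1
  rw [PiLp.inner_apply]
  refine Finset.sum_congr rfl fun i _ => ?_
  rw [real_inner_smul_left, real_inner_comm]
  simp only [RCLike.inner_apply, conj_trivial]
  ring

lemma continuous_diagAffine (c : Fin n → EuclideanSpace ℝ (Fin n)) (m : EuclideanSpace ℝ (Fin n))
    (s : Fin n → ℝ) : Continuous (diagAffine c m s) := by
  unfold diagAffine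
  fun_prop

lemma charFun_map_diagAffine (ν : Measure (EuclideanSpace ℝ (Fin n)))
    (c : Fin n → EuclideanSpace ℝ (Fin n)) (m : EuclideanSpace ℝ (Fin n)) (s : Fin n → ℝ)
    (t : EuclideanSpace ℝ (Fin n)) :
    charFun (ν.map (diagAffine c m s)) t = Complex.exp (Complex.I * ((inner ℝ t m : ℝ) : ℂ)) *
      charFun ν (WithLp.toLp 2 fun i => s i * inner ℝ t (c i)) := by
  rw [charFun_apply, integral_map (continuous_diagAffine c m s).aemeasurable
    (Continuous.aestronglyMeasurable (by fun_prop)), charFun_apply, ← integral_const_mul]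
  refine integral_congr_ae (Filter.Eventually.of_forall fun z => ?_)
  simp only
  rw [inner_diagAffine, ← Complex.exp_add]
  push_cast
  congr 1
  ring

lemma norm_sq_toLp_mul_inner {c : Fin n → EuclideanSpace ℝ (Fin n)} {s : Fin n → ℝ}
    (t : EuclideanSpace ℝ (Fin n)) :
    ‖(WithLp.toLp 2 fun i => s i * inner ℝ t (c i) : EuclideanSpace ℝ (Fin n))‖ ^ 2 =
      ∑ i, s i ^ 2 * (inner ℝ t (c i)) ^ 2 := by
  rw [EuclideanSpace.norm_sq_eq]
  simp [mul_pow]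

/-- An affine image of a spherical law with generator `ψ` is elliptical with generator `ψ`. -/
lemma isEllipticalLaw_map_diagAffine {ν : Measure (EuclideanSpace ℝ (Fin n))}
    [IsProbabilityMeasure ν] {ψ : ℝ → ℝ} (hν : ∀ t, charFun ν t = (ψ (‖t‖ ^ 2) : ℝ))
    {c : Fin n → EuclideanSpace ℝ (Fin n)} {m : EuclideanSpace ℝ (Fin n)} {s : Fin n → ℝ}
    {S : Matrix (Fin n) (Fin n) ℝ}
    (hS : ∀ t, inner ℝ t (mulVec S t) = ∑ i, s i ^ 2 * (inner ℝ t (c i)) ^ 2) :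
    IsEllipticalLaw m S ψ (ν.map (diagAffine c m s)) :=
  ⟨Measure.isProbabilityMeasure_map (continuous_diagAffine c m s).aemeasurable, fun t => by
    rw [charFun_map_diagAffine, hν, norm_sq_toLp_mul_inner, hS]⟩

/-- If `m + A'Z`, with `A` invertible, is elliptical with generator `ψ` and scale matrix `A'A`, then
`Z` is spherical with generator `ψ`. -/
lemma charFun_eq_of_isEllipticalLaw_map {ν : Measure (EuclideanSpace ℝ (Fin n))} {ψ : ℝ → ℝ}
    {m : EuclideanSpace ℝ (Fin n)} {A : Matrix (Fin n) (Fin n) ℝ} (hA : IsUnit A)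
    (h : IsEllipticalLaw m (A.transpose * A) ψ (ν.map fun z => m + mulVec A.transpose z))
    (u : EuclideanSpace ℝ (Fin n)) : charFun ν u = (ψ (‖u‖ ^ 2) : ℝ) := by
  have he : (fun z => m + mulVec A.transpose z) =
      diagAffine (fun i => WithLp.toLp 2 (A.transpose.col i)) m 1 := by
    ext z j
    simp [diagAffine, mulVec, Matrix.mulVec, dotProduct, mul_comm]
  obtain ⟨t, ht⟩ : ∃ t : EuclideanSpace ℝ (Fin n), (WithLp.toLp 2 fun i => (1 : Fin n → ℝ) i *
      inner ℝ t (WithLp.toLp 2 (A.transpose.col i)) : EuclideanSpace ℝ (Fin n)) = u := by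
    refine ⟨mulVec A⁻¹ u, ?_⟩
    have h1 : A.mulVec (A⁻¹.mulVec u.ofLp) = u.ofLp := by
      rw [Matrix.mulVec_mulVec,
        Matrix.mul_nonsing_inv A ((Matrix.isUnit_iff_isUnit_det A).1 hA), Matrix.one_mulVec]
    ext i
    conv_rhs => rw [← h1]
    simp [mulVec, PiLp.inner_apply, Matrix.mulVec, dotProduct]
  have hS := inner_mulVec_of_eq (S := A.transpose * A) (C := A.transpose) (d := 1)
    (by simp [Matrix.diagonal_one']) t
  have h2 := h.2 t
  rw [he, charFun_map_diagAffine, ht] at h2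
  rw [mul_left_cancel₀ (Complex.exp_ne_zero _) h2, hS, ← ht, norm_sq_toLp_mul_inner]
  simp

lemma IsEllipticalLaw.unique {m : EuclideanSpace ℝ (Fin n)} {S : Matrix (Fin n) (Fin n) ℝ}
    {ψ : ℝ → ℝ} {ν ν' : Measure (EuclideanSpace ℝ (Fin n))} (h : IsEllipticalLaw m S ψ ν)
    (h' : IsEllipticalLaw m S ψ ν') : ν = ν' := by
  have := h.1
  have := h'.1
  exact Measure.ext_of_charFun (funext fun t => (h.2 t).trans (h'.2 t).symm)

lemma map_diagAffine_absolutelyContinuous {ν : Measure (EuclideanSpace ℝ (Fin n))}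
    (hν : ν ≪ volume) {c : Fin n → EuclideanSpace ℝ (Fin n)} (hc : LinearIndependent ℝ c)
    (m : EuclideanSpace ℝ (Fin n)) {s : Fin n → ℝ} (hs : ∀ i, s i ≠ 0) :
    ν.map (diagAffine c m s) ≪ volume := by
  let L : EuclideanSpace ℝ (Fin n) →ₗ[ℝ] EuclideanSpace ℝ (Fin n) :=
    { toFun := fun z => ∑ i, (s i * z i) • c i
      map_add' := fun z w => by simp [mul_add, add_smul, Finset.sum_add_distrib]
      map_smul' := fun a z => by simp [Finset.smul_sum, smul_smul, mul_left_comm] }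
  have hL : LinearMap.det L ≠ 0 := by
    intro h0
    have hlt := LinearMap.bot_lt_ker_of_det_eq_zero h0
    refine hlt.ne' ((Submodule.eq_bot_iff _).2 fun z hz => ?_)
    have h := Fintype.linearIndependent_iff.1 hc (fun i => s i * z i) hz
    ext i
    simpa [hs i] using h i
  have hm : Measurable (diagAffine c m s) := (continuous_diagAffine c m s).measurable
  refine Measure.AbsolutelyContinuous.mk fun u hu h0 => ?_
  rw [Measure.map_apply hm hu]
  refine hν ?_
  have he : diagAffine c m s ⁻¹' u = L ⁻¹' ((fun x => m + x) ⁻¹' u) := rfl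
  rw [he, Measure.addHaar_preimage_linearMap _ hL, measure_preimage_add, h0, mul_zero]

lemma IsEllipticalLaw.exists_density {m : EuclideanSpace ℝ (Fin n)}
    {S : Matrix (Fin n) (Fin n) ℝ} {ψ : ℝ → ℝ} {ν : Measure (EuclideanSpace ℝ (Fin n))}
    (h : IsEllipticalLaw m S ψ ν) (hν : ν ≪ volume) : ∃ p, IsEllipticalDensity m S ψ p := by
  have := h.1
  refine ⟨fun x => (ν.rnDeriv volume x).toReal, (Measure.measurable_rnDeriv _ _).ennreal_toReal,
    fun _ => ENNReal.toReal_nonneg, ?_⟩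
  rwa [withDensity_congr_ae (g := ν.rnDeriv volume), Measure.withDensity_rnDeriv_eq _ _ hν]
  filter_upwards [Measure.rnDeriv_lt_top ν volume] with x hx
  exact ENNReal.ofReal_toReal hx.ne

/-- Integrals against a density, as integrals against the law. -/
lemma integral_mul_density {p : EuclideanSpace ℝ (Fin n) → ℝ} (hp : Measurable p)
    (hp0 : ∀ x, 0 ≤ p x) (h : EuclideanSpace ℝ (Fin n) → ℝ) :
    ∫ x, h x * p x = ∫ x, h x ∂(volume.withDensity fun x => ENNReal.ofReal (p x)) := by
  rw [integral_withDensity_eq_integral_toReal_smul (by fun_prop)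
    (Filter.Eventually.of_forall fun _ => ENNReal.ofReal_lt_top)]
  refine integral_congr_ae (Filter.Eventually.of_forall fun x => ?_)
  simp only [ENNReal.toReal_ofReal (hp0 x), smul_eq_mul, mul_comm]

lemma integrable_mul_density_iff {p : EuclideanSpace ℝ (Fin n) → ℝ} (hp : Measurable p)
    (hp0 : ∀ x, 0 ≤ p x) (h : EuclideanSpace ℝ (Fin n) → ℝ) :
    (Integrable fun x => h x * p x) ↔
      Integrable h (volume.withDensity fun x => ENNReal.ofReal (p x)) := by
  rw [integrable_withDensity_iff_integrable_smul' (by fun_prop)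
    (Filter.Eventually.of_forall fun _ => ENNReal.ofReal_lt_top)]
  refine integrable_congr (Filter.Eventually.of_forall fun x => ?_)
  simp only [ENNReal.toReal_ofReal (hp0 x), smul_eq_mul, mul_comm]

/-- For `S = C diag(d) C'`, the trace of `S` times the Hessian is a combination of second
derivatives along the columns of `C`. -/
lemma trace_mul_hessian {S C : Matrix (Fin n) (Fin n) ℝ} {d : Fin n → ℝ}
    (hS : S = C * Matrix.diagonal d * C.transpose) {f : EuclideanSpace ℝ (Fin n) → ℝ}
    (hf : ContDiff ℝ 2 f) (x : EuclideanSpace ℝ (Fin n)) :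
    (S * hessian f x).trace = ∑ i, d i * fderiv ℝ
      (fun y => fderiv ℝ f y (WithLp.toLp 2 (C.col i))) x (WithLp.toLp 2 (C.col i)) := by
  have hd : Differentiable ℝ (fderiv ℝ f) :=
    (hf.fderiv_right (m := 1) (by norm_num)).differentiable one_ne_zero
  have h2 : ∀ v w, fderiv ℝ (fun y => fderiv ℝ f y v) x w = fderiv ℝ (fderiv ℝ f) x w v := by
    intro v w
    rw [fderiv_clm_apply (hd x) (differentiableAt_const v)]
    simp
  have hc : ∀ i, (WithLp.toLp 2 (C.col i) : EuclideanSpace ℝ (Fin n)) =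
      ∑ j, C j i • EuclideanSpace.single j (1 : ℝ) := by
    intro i
    ext k
    simp [Pi.single_apply]
  rw [hS, Matrix.mul_assoc, Matrix.mul_assoc, Matrix.trace_mul_comm, Matrix.mul_assoc,
    Matrix.mul_assoc]
  simp only [Matrix.trace, Matrix.diag_apply, Matrix.diagonal_mul, h2]
  refine Finset.sum_congr rfl fun i _ => ?_
  congr 1
  rw [hc i]
  simp only [map_sum, map_smul, sum_apply, smul_apply,
    smul_eq_mul, Matrix.mul_apply, Matrix.transpose_apply, hessian, Matrix.of_apply, h2,
    Finset.mul_sum]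
  refine Finset.sum_comm.trans (Finset.sum_congr rfl fun j _ => Finset.sum_congr rfl fun k _ => ?_)
  ring

/-! ### The path of affine maps along the segment -/

lemma exists_linear_growth {F : Type*} [NormedAddCommGroup F]
    {g : EuclideanSpace ℝ (Fin n) → F} (hg : Continuous g)
    (hO : g =O[Bornology.cobounded (EuclideanSpace ℝ (Fin n))] fun x => ‖x‖) :
    ∃ K, 0 ≤ K ∧ ∀ x, ‖g x‖ ≤ K * (1 + ‖x‖) := by
  obtain ⟨K, hK0, hK⟩ := hO.exists_nonneg
  rw [Asymptotics.isBigOWith_iff,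
    (Metric.hasBasis_cobounded_compl_closedBall
      (0 : EuclideanSpace ℝ (Fin n))).eventually_iff] at hK
  obtain ⟨r, -, hr⟩ := hK
  obtain ⟨B, hB⟩ := (isCompact_closedBall (0 : EuclideanSpace ℝ (Fin n))
    r).exists_bound_of_continuousOn hg.continuousOn
  refine ⟨K + |B|, by positivity, fun x => ?_⟩
  by_cases hx : x ∈ Metric.closedBall 0 r
  · have := (hB x hx).trans (le_abs_self B)
    nlinarith [norm_nonneg x, abs_nonneg B, mul_nonneg hK0 (norm_nonneg x),
      mul_nonneg (abs_nonneg B) (norm_nonneg x)]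
  · have := hr hx
    rw [norm_norm] at this
    nlinarith [norm_nonneg x, abs_nonneg B, mul_nonneg (abs_nonneg B) (norm_nonneg x)]

lemma norm_diagAffine_le (c : Fin n → EuclideanSpace ℝ (Fin n))
    {m : EuclideanSpace ℝ (Fin n)} {s : Fin n → ℝ} {K L : ℝ} (hm : ‖m‖ ≤ K)
    (hs : ∀ i, |s i| ≤ L) (hL : 0 ≤ L) (z : EuclideanSpace ℝ (Fin n)) :
    ‖diagAffine c m s z‖ ≤ (K + L * ∑ i, ‖c i‖) * (1 + ‖z‖) := by
  have hK : 0 ≤ K := (norm_nonneg _).trans hm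
  have h1 : ‖∑ i, (s i * z i) • c i‖ ≤ L * (∑ i, ‖c i‖) * ‖z‖ := by
    refine (norm_sum_le _ _).trans ?_
    rw [Finset.mul_sum, Finset.sum_mul]
    refine Finset.sum_le_sum fun i _ => ?_
    rw [norm_smul, norm_mul, Real.norm_eq_abs, mul_right_comm]
    gcongr
    · exact hs i
    · exact PiLp.norm_apply_le z i
  have h2 : 0 ≤ L * ∑ i, ‖c i‖ := mul_nonneg hL (Finset.sum_nonneg fun i _ => norm_nonneg _)
  have := norm_add_le m (∑ i, (s i * z i) • c i)
  rw [diagAffine]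
  nlinarith [norm_nonneg z]

/-- The square roots `√(l dᵢ + 1 - l)` of the eigenvalues of the interpolated scale matrix. -/
noncomputable def scale (d : Fin n → ℝ) (l : ℝ) (i : Fin n) : ℝ := √(l * d i + (1 - l))

/-- The derivative of `scale d l i` in `l`. -/
noncomputable def rate (d : Fin n → ℝ) (l : ℝ) (i : Fin n) : ℝ := (d i - 1) / (2 * scale d l i)

lemma scale_arg_pos {d : Fin n → ℝ} (hd : ∀ i, 0 < d i) {l : ℝ} (hl : l ∈ Set.Icc (0 : ℝ) 1)
    (i : Fin n) : 0 < l * d i + (1 - l) := by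
  rcases hl.1.eq_or_lt with h | h
  · simp [← h]
  · have := mul_pos h (hd i)
    linarith [hl.2]

lemma scale_pos {d : Fin n → ℝ} (hd : ∀ i, 0 < d i) {l : ℝ} (hl : l ∈ Set.Icc (0 : ℝ) 1)
    (i : Fin n) : 0 < scale d l i :=
  Real.sqrt_pos.2 (scale_arg_pos hd hl i)

lemma scale_sq {d : Fin n → ℝ} (hd : ∀ i, 0 < d i) {l : ℝ} (hl : l ∈ Set.Icc (0 : ℝ) 1)
    (i : Fin n) : scale d l i ^ 2 = l * d i + (1 - l) :=
  Real.sq_sqrt (scale_arg_pos hd hl i).le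

lemma continuous_scale (d : Fin n → ℝ) (i : Fin n) : Continuous fun l => scale d l i := by
  unfold scale
  fun_prop

lemma continuousOn_rate {d : Fin n → ℝ} (hd : ∀ i, 0 < d i) (i : Fin n) :
    ContinuousOn (fun l => rate d l i) (Set.Icc 0 1) :=
  continuousOn_const.div (continuous_const.mul (continuous_scale d i)).continuousOn
    fun _ hl => (mul_pos two_pos (scale_pos hd hl i)).ne'

lemma measurable_rate (d : Fin n → ℝ) (i : Fin n) : Measurable fun l => rate d l i :=
  measurable_const.div (continuous_const.mul (continuous_scale d i)).measurable

lemma exists_bound_of_continuousOn_Icc {s : ℝ → Fin n → ℝ}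
    (hs : ∀ i, ContinuousOn (fun l => s l i) (Set.Icc 0 1)) :
    ∃ L, 0 ≤ L ∧ ∀ l ∈ Set.Icc (0 : ℝ) 1, ∀ i, |s l i| ≤ L := by
  choose B hB using fun i => isCompact_Icc.exists_bound_of_continuousOn (hs i)
  refine ⟨∑ i, |B i|, Finset.sum_nonneg fun i _ => abs_nonneg _, fun l hl i => ?_⟩
  exact ((hB i l hl).trans (le_abs_self _)).trans
    (Finset.single_le_sum (f := fun i => |B i|) (fun i _ => abs_nonneg _) (Finset.mem_univ i))

/-- The map pushing a spherical law to the elliptical law at the point `l` of the segment. -/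
noncomputable def path (c : Fin n → EuclideanSpace ℝ (Fin n)) (mx my : EuclideanSpace ℝ (Fin n))
    (d : Fin n → ℝ) (l : ℝ) (z : EuclideanSpace ℝ (Fin n)) : EuclideanSpace ℝ (Fin n) :=
  diagAffine c (interp mx my l) (scale d l) z

lemma continuous_path (c : Fin n → EuclideanSpace ℝ (Fin n)) (mx my : EuclideanSpace ℝ (Fin n))
    (d : Fin n → ℝ) :
    Continuous fun p : ℝ × EuclideanSpace ℝ (Fin n) => path c mx my d p.1 p.2 := by
  have := continuous_scale d
  have h : ∀ i, Continuous fun p : ℝ × EuclideanSpace ℝ (Fin n) => scale d p.1 i :=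
    fun i => (this i).comp continuous_fst
  unfold path diagAffine interp
  fun_prop

lemma exists_norm_path_le (c : Fin n → EuclideanSpace ℝ (Fin n))
    (mx my : EuclideanSpace ℝ (Fin n)) (d : Fin n → ℝ) :
    ∃ K, 0 ≤ K ∧ ∀ l ∈ Set.Icc (0 : ℝ) 1, ∀ z, ‖path c mx my d l z‖ ≤ K * (1 + ‖z‖) := by
  obtain ⟨L, hL, h⟩ := exists_bound_of_continuousOn_Icc
    fun i => (continuous_scale d i).continuousOn
  refine ⟨(‖my‖ + ‖mx‖) + L * ∑ i, ‖c i‖, by positivity, fun l hl z => ?_⟩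
  refine norm_diagAffine_le c ?_ (h l hl) hL z
  refine (norm_add_le _ _).trans (add_le_add ?_ ?_)
  · rw [norm_smul, Real.norm_eq_abs, abs_of_nonneg hl.1]
    exact mul_le_of_le_one_left (norm_nonneg _) hl.2
  · rw [norm_smul, Real.norm_eq_abs, abs_of_nonneg (by linarith [hl.2])]
    exact mul_le_of_le_one_left (norm_nonneg _) (by linarith [hl.1])

lemma hasDerivAt_path (c : Fin n → EuclideanSpace ℝ (Fin n)) (mx my : EuclideanSpace ℝ (Fin n))
    {d : Fin n → ℝ} (hd : ∀ i, 0 < d i) {l : ℝ} (hl : l ∈ Set.Icc (0 : ℝ) 1)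
    (z : EuclideanSpace ℝ (Fin n)) :
    HasDerivAt (fun l => path c mx my d l z) ((my - mx) + diagAffine c 0 (rate d l) z) l := by
  have h1 : HasDerivAt (fun l => interp mx my l) (my - mx) l := by
    have h : HasDerivAt (fun l => interp mx my l) ((1 : ℝ) • my + (-1 : ℝ) • mx) l :=
      ((hasDerivAt_id l).smul_const my).add (((hasDerivAt_id l).const_sub 1).smul_const mx)
    rwa [one_smul, neg_one_smul, ← sub_eq_add_neg] at h
  have h2 : ∀ i, HasDerivAt (fun l => scale d l i) (rate d l i) l := by
    intro i
    have h : HasDerivAt (fun l => scale d l i) ((1 * d i + -1) / (2 * scale d l i)) l :=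
      (((hasDerivAt_id l).mul_const (d i)).add ((hasDerivAt_id l).const_sub 1)).sqrt
        (scale_arg_pos hd hl i).ne'
    rwa [one_mul, ← sub_eq_add_neg] at h
  have h3 : HasDerivAt (fun l => ∑ i, (scale d l i * z i) • c i)
      (∑ i, (rate d l i * z i) • c i) l :=
    HasDerivAt.fun_sum fun i _ => ((h2 i).mul_const (z i)).smul_const (c i)
  have := h1.add h3
  rw [diagAffine, zero_add]
  exact this

/-- The growth of the integrands along the path is controlled by the second moment of the spherical
law. -/
lemma integrable_fderiv_path (hn : 0 < n) {ρ : Measure ℝ} [IsProbabilityMeasure ρ]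
    (hρ : Integrable (fun r => r ^ 2) ρ) (c : Fin n → EuclideanSpace ℝ (Fin n))
    (mx my : EuclideanSpace ℝ (Fin n)) (d : Fin n → ℝ)
    {f : EuclideanSpace ℝ (Fin n) → ℝ} (hf : ContDiff ℝ 2 f)
    {K : ℝ} (hK0 : 0 ≤ K) (hK : ∀ x, ‖fderiv ℝ f x‖ ≤ K * (1 + ‖x‖))
    {v : ℝ → EuclideanSpace ℝ (Fin n) → EuclideanSpace ℝ (Fin n)}
    (hv : Measurable v.uncurry) {L : ℝ}
    (hL : ∀ l ∈ Set.Icc (0 : ℝ) 1, ∀ z, ‖v l z‖ ≤ L * (1 + ‖z‖)) :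
    Integrable (fun p : ℝ × EuclideanSpace ℝ (Fin n) =>
        fderiv ℝ f (path c mx my d p.1 p.2) (v p.1 p.2))
      ((volume.restrict (Set.Ioc 0 1)).prod (sphereMixture n ρ)) ∧
    ∀ l ∈ Set.Icc (0 : ℝ) 1,
      Integrable (fun z => fderiv ℝ f (path c mx my d l z) (v l z)) (sphereMixture n ρ) := by
  have := isProbabilityMeasure_sphereMixture hn ρ
  obtain ⟨B, hB0, hB⟩ := exists_norm_path_le c mx my d
  have hdom : ∀ l ∈ Set.Icc (0 : ℝ) 1, ∀ z,
      ‖fderiv ℝ f (path c mx my d l z) (v l z)‖ ≤ (K * (1 + B) * L) * (1 + ‖z‖) ^ 2 := by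
    intro l hl z
    have h1 : ‖fderiv ℝ f (path c mx my d l z)‖ ≤ K * (1 + B) * (1 + ‖z‖) := by
      refine (hK _).trans ?_
      rw [mul_assoc]
      refine mul_le_mul_of_nonneg_left ?_ hK0
      nlinarith [hB l hl z, norm_nonneg z]
    calc _ ≤ ‖fderiv ℝ f (path c mx my d l z)‖ * ‖v l z‖ := ContinuousLinearMap.le_opNorm _ _
      _ ≤ (K * (1 + B) * (1 + ‖z‖)) * (L * (1 + ‖z‖)) :=
        mul_le_mul h1 (hL l hl z) (norm_nonneg _) (by positivity)
      _ = _ := by ring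
  have hm : Measurable fun p : ℝ × EuclideanSpace ℝ (Fin n) =>
      fderiv ℝ f (path c mx my d p.1 p.2) (v p.1 p.2) := by
    have h1 : Continuous fun p : ℝ × EuclideanSpace ℝ (Fin n) =>
        fderiv ℝ f (path c mx my d p.1 p.2) :=
      (hf.continuous_fderiv two_ne_zero).comp (continuous_path c mx my d)
    exact isBoundedBilinearMap_apply.continuous.measurable.comp (h1.measurable.prodMk hv)
  have hi := (integrable_one_add_norm_sq_sphereMixture hn hρ).const_mul (K * (1 + B) * L)
  constructor
  · refine (hi.comp_snd (volume.restrict (Set.Ioc (0 : ℝ) 1))).mono' hm.aestronglyMeasurable ?_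
    have h : ∀ᵐ p ∂((volume.restrict (Set.Ioc (0 : ℝ) 1)).prod (sphereMixture n ρ)),
        p.1 ∈ Set.Ioc (0 : ℝ) 1 :=
      Measure.quasiMeasurePreserving_fst.ae (ae_restrict_mem measurableSet_Ioc)
    filter_upwards [h] with p hp
    exact hdom p.1 (Set.Ioc_subset_Icc_self hp) p.2
  · intro l hl
    exact hi.mono' (hm.comp measurable_prodMk_left).aestronglyMeasurable
      (Filter.Eventually.of_forall fun z => hdom l hl z)

lemma integrable_comp_path (hn : 0 < n) {ρ : Measure ℝ} [IsProbabilityMeasure ρ]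
    (hρ : Integrable (fun r => r ^ 2) ρ) (c : Fin n → EuclideanSpace ℝ (Fin n))
    (mx my : EuclideanSpace ℝ (Fin n)) (d : Fin n → ℝ)
    {f : EuclideanSpace ℝ (Fin n) → ℝ} (hf : Continuous f)
    {K : ℝ} (hK0 : 0 ≤ K) (hK : ∀ x, ‖f x‖ ≤ K * (1 + ‖x‖)) {l : ℝ}
    (hl : l ∈ Set.Icc (0 : ℝ) 1) :
    Integrable (fun z => f (path c mx my d l z)) (sphereMixture n ρ) := by
  obtain ⟨B, hB0, hB⟩ := exists_norm_path_le c mx my d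
  have hc : Continuous fun z => path c mx my d l z :=
    (continuous_path c mx my d).comp (by fun_prop : Continuous fun z => (l, z))
  refine ((integrable_one_add_norm_sq_sphereMixture hn hρ).const_mul (K * (1 + B))).mono'
    (hf.comp hc).aestronglyMeasurable (Filter.Eventually.of_forall fun z => ?_)
  refine (hK _).trans ?_
  rw [mul_assoc]
  refine mul_le_mul_of_nonneg_left ?_ hK0
  nlinarith [hB l hl z, norm_nonneg z, mul_nonneg hB0 (norm_nonneg z),
    mul_nonneg hB0 (sq_nonneg ‖z‖)]

/-- Differentiation along the path: the fundamental theorem of calculus for each point `z`,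
integrated over the spherical law. -/
lemma integral_path_sub (hn : 0 < n) {ρ : Measure ℝ} [IsProbabilityMeasure ρ]
    (hρ : Integrable (fun r => r ^ 2) ρ) (c : Fin n → EuclideanSpace ℝ (Fin n))
    (mx my : EuclideanSpace ℝ (Fin n)) {d : Fin n → ℝ} (hd : ∀ i, 0 < d i)
    {f : EuclideanSpace ℝ (Fin n) → ℝ} (hf : ContDiff ℝ 2 f)
    {K₀ : ℝ} (hK0' : 0 ≤ K₀) (hK' : ∀ x, ‖f x‖ ≤ K₀ * (1 + ‖x‖))
    {K : ℝ} (hK0 : 0 ≤ K) (hK : ∀ x, ‖fderiv ℝ f x‖ ≤ K * (1 + ‖x‖)) :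
    (∀ l ∈ Set.Icc (0 : ℝ) 1,
      Integrable (fun z => fderiv ℝ f (path c mx my d l z) (my - mx)) (sphereMixture n ρ)) ∧
    (∀ l ∈ Set.Icc (0 : ℝ) 1, Integrable (fun z => fderiv ℝ f (path c mx my d l z)
      (diagAffine c 0 (rate d l) z)) (sphereMixture n ρ)) ∧
    IntervalIntegrable (fun l => ∫ z, fderiv ℝ f (path c mx my d l z) (my - mx)
      ∂(sphereMixture n ρ)) volume 0 1 ∧
    IntervalIntegrable (fun l => ∫ z, fderiv ℝ f (path c mx my d l z)
      (diagAffine c 0 (rate d l) z) ∂(sphereMixture n ρ)) volume 0 1 ∧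
    (∫ z, f (path c mx my d 1 z) ∂(sphereMixture n ρ)) -
        ∫ z, f (path c mx my d 0 z) ∂(sphereMixture n ρ) =
      (∫ l in (0 : ℝ)..1, ∫ z, fderiv ℝ f (path c mx my d l z) (my - mx) ∂(sphereMixture n ρ)) +
      ∫ l in (0 : ℝ)..1, ∫ z, fderiv ℝ f (path c mx my d l z)
        (diagAffine c 0 (rate d l) z) ∂(sphereMixture n ρ) := by
  have := isProbabilityMeasure_sphereMixture hn ρ
  obtain ⟨L, hL0, hL⟩ := exists_bound_of_continuousOn_Icc (continuousOn_rate hd)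
  have hvm : Measurable (Function.uncurry fun (l : ℝ) z => diagAffine c 0 (rate d l) z) := by
    have h : ∀ i, Measurable fun p : ℝ × EuclideanSpace ℝ (Fin n) => rate d p.1 i :=
      fun i => (measurable_rate d i).comp measurable_fst
    simp only [diagAffine, Function.uncurry_def]
    fun_prop
  obtain ⟨hm1, hm2⟩ := integrable_fderiv_path hn hρ c mx my d hf hK0 hK
    (v := fun _ _ => my - mx) (by fun_prop) (L := ‖my - mx‖)
    (fun l _ z => le_mul_of_one_le_right (norm_nonneg _) (by linarith [norm_nonneg z]))
  obtain ⟨hz1, hz2⟩ := integrable_fderiv_path hn hρ c mx my d hf hK0 hK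
    hvm (fun l hl z => norm_diagAffine_le c norm_zero.le
      (hL l hl) hL0 z)
  have hmi : IntervalIntegrable (fun l => ∫ z, fderiv ℝ f (path c mx my d l z) (my - mx)
      ∂(sphereMixture n ρ)) volume 0 1 :=
    (intervalIntegrable_iff_integrableOn_Ioc_of_le zero_le_one).2 hm1.integral_prod_left
  have hzi : IntervalIntegrable (fun l => ∫ z, fderiv ℝ f (path c mx my d l z)
      (diagAffine c 0 (rate d l) z) ∂(sphereMixture n ρ)) volume 0 1 :=
    (intervalIntegrable_iff_integrableOn_Ioc_of_le zero_le_one).2 hz1.integral_prod_left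
  refine ⟨hm2, hz2, hmi, hzi, ?_⟩
  rw [← integral_sub
    (integrable_comp_path hn hρ c mx my d hf.continuous hK0' hK' (by simp))
    (integrable_comp_path hn hρ c mx my d hf.continuous hK0' hK' (by simp)),
    ← intervalIntegral.integral_add hmi hzi]
  have hftc : ∀ z, f (path c mx my d 1 z) - f (path c mx my d 0 z) =
      ∫ l in Set.Ioc (0 : ℝ) 1, (fderiv ℝ f (path c mx my d l z) (my - mx) +
        fderiv ℝ f (path c mx my d l z) (diagAffine c 0 (rate d l) z)) := by
    intro z
    have hcp : Continuous fun l => path c mx my d l z :=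
      (continuous_path c mx my d).comp (by fun_prop : Continuous fun l => (l, z))
    have hcf : Continuous fun l => fderiv ℝ f (path c mx my d l z) :=
      (hf.continuous_fderiv two_ne_zero).comp hcp
    have hcv : ContinuousOn (fun l => diagAffine c 0 (rate d l) z) (Set.Icc 0 1) := by
      have := continuousOn_rate hd
      unfold diagAffine
      fun_prop
    rw [← intervalIntegral.integral_of_le zero_le_one]
    symm
    refine intervalIntegral.integral_eq_sub_of_hasDerivAt
      (f := fun l => f (path c mx my d l z)) (fun l hl => ?_) ?_
    · rw [Set.uIcc_of_le zero_le_one] at hl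
      rw [← map_add]
      exact ((hf.differentiable two_ne_zero _).hasFDerivAt).comp_hasDerivAt l
        (hasDerivAt_path c mx my hd hl z)
    · refine ContinuousOn.intervalIntegrable ?_
      rw [Set.uIcc_of_le zero_le_one]
      exact (hcf.continuousOn.clm_apply continuousOn_const).add (hcf.continuousOn.clm_apply hcv)
  simp only [hftc]
  rw [intervalIntegral.integral_of_le zero_le_one, ← integral_integral_swap
    (f := fun l z => fderiv ℝ f (path c mx my d l z) (my - mx) +
      fderiv ℝ f (path c mx my d l z) (diagAffine c 0 (rate d l) z)) (hm1.add hz1)]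
  refine setIntegral_congr_fun measurableSet_Ioc fun l hl => ?_
  have hl' := Set.Ioc_subset_Icc_self hl
  exact integral_add (hm2 l hl') (hz2 l hl')

/-- For a fixed point of the segment, the scale part of the derivative is a Hessian term, by the
Stein-type identity. -/
lemma integral_fderiv_path_eq (hn : 0 < n) {ρ : Measure ℝ} [IsProbabilityMeasure ρ]
    (hρ : Integrable (fun r => r ^ 2) ρ) (hM : 0 < ∫ r, r ^ 2 ∂ρ)
    (c : Fin n → EuclideanSpace ℝ (Fin n))
    (mx my : EuclideanSpace ℝ (Fin n)) {d : Fin n → ℝ} (hd : ∀ i, 0 < d i)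
    {f : EuclideanSpace ℝ (Fin n) → ℝ} (hf : ContDiff ℝ 2 f) {l : ℝ}
    (hl : l ∈ Set.Icc (0 : ℝ) 1)
    (h0 : Integrable (fun z => fderiv ℝ f (path c mx my d l z)
      (diagAffine c 0 (rate d l) z)) (sphereMixture n ρ))
    (h1 : Integrable (fun z => ∑ i, (d i - 1) *
      fderiv ℝ (fun y => fderiv ℝ f y (c i)) (path c mx my d l z) (c i)) (ballMixture n ρ)) :
    ∫ z, fderiv ℝ f (path c mx my d l z) (diagAffine c 0 (rate d l) z) ∂(sphereMixture n ρ) =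
      (∫ r, r ^ 2 ∂ρ) / (2 * n) * ∫ z, ∑ i, (d i - 1) *
        fderiv ℝ (fun y => fderiv ℝ f y (c i)) (path c mx my d l z) (c i) ∂(ballMixture n ρ) := by
  let F : Fin n → EuclideanSpace ℝ (Fin n) → ℝ :=
    fun i z => rate d l i * fderiv ℝ f (path c mx my d l z) (c i)
  have hf1 : ContDiff ℝ 1 (fderiv ℝ f) := hf.fderiv_right (by norm_num)
  have hp : ContDiff ℝ 1 (path c mx my d l) := by
    unfold path diagAffine
    fun_prop
  have hF : ∀ i, ContDiff ℝ 1 (F i) := fun i =>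
    contDiff_const.mul ((hf1.comp hp).clm_apply contDiff_const)
  have hdF : ∀ z, ∑ i, fderiv ℝ (F i) z (EuclideanSpace.single i 1) = 2⁻¹ * ∑ i, (d i - 1) *
      fderiv ℝ (fun y => fderiv ℝ f y (c i)) (path c mx my d l z) (c i) := by
    intro z
    rw [Finset.mul_sum]
    refine Finset.sum_congr rfl fun i _ => ?_
    have hg : DifferentiableAt ℝ (fun y => fderiv ℝ f y (c i)) (path c mx my d l z) :=
      (hf1.clm_apply contDiff_const).differentiable one_ne_zero _
    have hpl : HasLineDerivAt ℝ (path c mx my d l) (scale d l i • c i) z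
        (EuclideanSpace.single i 1) := by
      have he : (fun t : ℝ => path c mx my d l (z + t • EuclideanSpace.single i 1)) =
          fun t => path c mx my d l z + t • (scale d l i • c i) := by
        ext1 t
        simp only [path, diagAffine, add_assoc]
        congr 1
        simp [mul_add, add_smul, Finset.sum_add_distrib, smul_smul, mul_comm]
      rw [HasLineDerivAt, he]
      simpa using ((hasDerivAt_id (0 : ℝ)).smul_const (scale d l i • c i)).const_add
        (path c mx my d l z)
    have hpe : fderiv ℝ (path c mx my d l) z (EuclideanSpace.single i 1) = scale d l i • c i := by
      rw [← (hp.differentiable one_ne_zero z).lineDeriv_eq_fderiv, hpl.lineDeriv]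
    have h := (hg.hasFDerivAt.comp z (hp.differentiable one_ne_zero z).hasFDerivAt).const_mul
      (rate d l i)
    rw [HasFDerivAt.fderiv (f := F i) h]
    have hs := (scale_pos hd hl i).ne'
    simp only [smul_apply, ContinuousLinearMap.comp_apply, hpe, map_smul,
      smul_eq_mul, rate]
    field_simp
  have hz : ∀ z, fderiv ℝ f (path c mx my d l z) (diagAffine c 0 (rate d l) z) =
      ∑ i, z i * F i z := by
    intro z
    simp only [diagAffine, zero_add, map_sum, map_smul, smul_eq_mul, F]
    exact Finset.sum_congr rfl fun i _ => by ring
  simp only [hz] at h0 ⊢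
  rw [integral_sphereMixture_sum_eq hn hρ hM hF h0 (by simpa only [hdF] using h1.const_mul _)]
  simp only [hdF]
  rw [integral_const_mul]
  ring

/-! ### The interpolation formula -/

lemma sphereMixture_eq_map {Ω : Type*} [MeasurableSpace Ω] {P : Measure Ω} [IsProbabilityMeasure P]
    {R : Ω → ℝ} {U : Ω → EuclideanSpace ℝ (Fin n)} (hR : AEMeasurable R P)
    (hU : HasLaw U (uniformSphere n) P) (hRU : IndepFun R U P) :
    sphereMixture n (P.map R) = P.map fun ω => R ω • U ω := by
  rw [sphereMixture, ← hU.map_eq,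
    ← (indepFun_iff_map_prod_eq_prod_map_map hR hU.aemeasurable).1 hRU,
    AEMeasurable.map_map_of_aemeasurable (by fun_prop) (hR.prodMk hU.aemeasurable)]
  rfl

/-- A law without atoms has a non-degenerate generating variate. -/
lemma integral_sq_pos_of_absolutelyContinuous (hn : 0 < n) {Ω : Type*} [MeasurableSpace Ω]
    {P : Measure Ω} [IsProbabilityMeasure P] {R : Ω → ℝ} {U : Ω → EuclideanSpace ℝ (Fin n)}
    (hR2 : Integrable (fun ω => R ω ^ 2) P) {Z : Ω → EuclideanSpace ℝ (Fin n)}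
    (hZ : AEMeasurable Z P) {m : EuclideanSpace ℝ (Fin n)} {A : Matrix (Fin n) (Fin n) ℝ}
    (hZR : ∀ ω, Z ω = m + R ω • mulVec A (U ω)) (hac : P.map Z ≪ volume) :
    0 < ∫ ω, R ω ^ 2 ∂P := by
  have : NeZero n := ⟨hn.ne'⟩
  refine (integral_nonneg fun ω => sq_nonneg _).lt_of_ne fun h0 => ?_
  have hR0 := (integral_eq_zero_iff_of_nonneg (fun ω => sq_nonneg (R ω)) hR2).1 h0.symm
  have h1 : P.map Z {m} = 0 := hac (measure_singleton m)
  rw [Measure.map_apply_of_aemeasurable hZ (measurableSet_singleton m)] at h1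
  have h2 : ∀ᵐ ω ∂P, Z ω ∈ ({m} : Set (EuclideanSpace ℝ (Fin n))) := by
    filter_upwards [hR0] with ω hω
    have : R ω = 0 := by simpa using hω
    simp [hZR, this]
  have h3 := measure_eq_zero_iff_ae_notMem.1 h1
  obtain ⟨ω, h4, h5⟩ := (h2.and h3).exists
  exact h5 h4

lemma inner_gradient {f : EuclideanSpace ℝ (Fin n) → ℝ} (v x : EuclideanSpace ℝ (Fin n)) :
    inner ℝ v (gradient f x) = fderiv ℝ f x v := by
  rw [real_inner_comm, gradient, InnerProductSpace.toDual_symm_apply]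

end Elliptical

open Elliptical

theorem lemma2p5
    {n : ℕ} (hn : 0 < n)
    {Ω Ω' Ω₀ : Type*} [MeasurableSpace Ω] [MeasurableSpace Ω'] [MeasurableSpace Ω₀]
    (P : Measure Ω) [IsProbabilityMeasure P]
    (P' : Measure Ω') [IsProbabilityMeasure P']
    (P₀ : Measure Ω₀) [IsProbabilityMeasure P₀]
    (X : Ω → EuclideanSpace ℝ (Fin n)) (Y : Ω' → EuclideanSpace ℝ (Fin n))
    (hX : AEMeasurable X P) (hY : AEMeasurable Y P')
    (mx my : EuclideanSpace ℝ (Fin n)) (Sx Sy : Matrix (Fin n) (Fin n) ℝ)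
    (hSx : Sx.PosDef) (hSy : Sy.PosDef) (ψ : ℝ → ℝ)
    (hXell : Elliptical.IsEllipticalLaw mx Sx ψ (P.map X))
    (hYell : Elliptical.IsEllipticalLaw my Sy ψ (P'.map Y))
    -- the generating variate `R` of `X`: `X` has the law of `mx + R A'U`
    (R : Ω₀ → ℝ) (U : Ω₀ → EuclideanSpace ℝ (Fin n)) (A : Matrix (Fin n) (Fin n) ℝ)
    (hR : AEMeasurable R P₀) (hR0 : ∀ᵐ ω ∂P₀, 0 ≤ R ω)
    (hU : HasLaw U (Elliptical.uniformSphere n) P₀) (hRU : IndepFun R U P₀)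
    (hA : A.transpose * A = Sx)
    (hXR : IdentDistrib X (fun ω => mx + R ω • Elliptical.mulVec A.transpose (U ω)) P P₀)
    (hR2 : Integrable (fun ω => R ω ^ 2) P₀)
    -- the density `φ l` of the interpolated law with generator `ψ`
    (φ : ℝ → EuclideanSpace ℝ (Fin n) → ℝ)
    (hφ : ∀ l ∈ Set.Icc (0 : ℝ) 1, Elliptical.IsEllipticalDensity
      (Elliptical.interp mx my l) (Elliptical.interp Sx Sy l) ψ (φ l))
    (f : EuclideanSpace ℝ (Fin n) → ℝ) (hf : ContDiff ℝ 2 f)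
    (hfO : f =O[Bornology.cobounded (EuclideanSpace ℝ (Fin n))] fun x => ‖x‖)
    (hgO : gradient f =O[Bornology.cobounded (EuclideanSpace ℝ (Fin n))] fun x => ‖x‖) :
    -- the interpolated laws with generator `ψ₁` exist and have densities
    (∀ l ∈ Set.Icc (0 : ℝ) 1, ∃ p : EuclideanSpace ℝ (Fin n) → ℝ, Elliptical.IsEllipticalDensity
      (Elliptical.interp mx my l) (Elliptical.interp Sx Sy l)
      (Elliptical.psi1 n (P₀.map R)) p) ∧
    ∀ φ₁ : ℝ → EuclideanSpace ℝ (Fin n) → ℝ,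
      (∀ l ∈ Set.Icc (0 : ℝ) 1, Elliptical.IsEllipticalDensity
        (Elliptical.interp mx my l) (Elliptical.interp Sx Sy l)
        (Elliptical.psi1 n (P₀.map R)) (φ₁ l)) →
      -- the inner integrals of the Hessian term exist
      (∀ᵐ l ∂(volume.restrict (Set.Icc (0 : ℝ) 1)),
        Integrable fun x => ((Sy - Sx) * Elliptical.hessian f x).trace * φ₁ l x) →
      Integrable (fun ω => f (X ω)) P ∧
      Integrable (fun ω => f (Y ω)) P' ∧
      (∀ l ∈ Set.Icc (0 : ℝ) 1, Integrable fun x => inner ℝ (my - mx) (gradient f x) * φ l x) ∧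
      IntervalIntegrable (fun l => ∫ x, inner ℝ (my - mx) (gradient f x) * φ l x) volume 0 1 ∧
      IntervalIntegrable
        (fun l => ∫ x, ((Sy - Sx) * Elliptical.hessian f x).trace * φ₁ l x) volume 0 1 ∧
      (∫ ω, f (Y ω) ∂P') - (∫ ω, f (X ω) ∂P) =
        (∫ l in (0 : ℝ)..1, ∫ x, inner ℝ (my - mx) (gradient f x) * φ l x) +
          (∫ ω, R ω ^ 2 ∂P₀) / (2 * n) *
            ∫ l in (0 : ℝ)..1, ∫ x, ((Sy - Sx) * Elliptical.hessian f x).trace * φ₁ l x := by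
  have hPX : IsProbabilityMeasure (P₀.map R) := Measure.isProbabilityMeasure_map hR
  set ρ := P₀.map R with hρdef
  have hρ : Integrable (fun r => r ^ 2) ρ :=
    (integrable_map_measure (Continuous.aestronglyMeasurable (by fun_prop)) hR).2 hR2
  have hρM : ∫ r, r ^ 2 ∂ρ = ∫ ω, R ω ^ 2 ∂P₀ :=
    integral_map hR (Continuous.aestronglyMeasurable (by fun_prop))
  obtain ⟨C, d, hC, hd, hCx, hCy⟩ := exists_simultaneous_diagonalization hSx hSy hA
  set c : Fin n → EuclideanSpace ℝ (Fin n) := fun i => WithLp.toLp 2 (C.col i) with hc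
  have hcli : LinearIndependent ℝ c := by
    have h := Matrix.linearIndependent_cols_of_isUnit hC
    exact h.map' (WithLp.linearEquiv 2 ℝ (Fin n → ℝ)).symm.toLinearMap (LinearEquiv.ker _)
  have h01 : (0 : ℝ) ∈ Set.Icc (0 : ℝ) 1 := by simp
  have h11 : (1 : ℝ) ∈ Set.Icc (0 : ℝ) 1 := by simp
  -- the scale matrices along the segment, in the diagonalizing coordinates
  have hS : ∀ l ∈ Set.Icc (0 : ℝ) 1, ∀ t, inner ℝ t (mulVec (interp Sx Sy l) t) =
      ∑ i, scale d l i ^ 2 * (inner ℝ t (c i)) ^ 2 := by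
    intro l hl t
    rw [inner_mulVec_of_eq (C := C) (d := fun i => scale d l i ^ 2)]
    simp only [scale_sq hd hl]
    have : Matrix.diagonal (fun i => l * d i + (1 - l)) =
        l • Matrix.diagonal d + (1 - l) • (1 : Matrix (Fin n) (Fin n) ℝ) := by
      ext i j
      by_cases h : i = j
      · subst h; simp
      · simp [h]
    rw [this, Matrix.mul_add, Matrix.add_mul, interp]
    nth_rewrite 1 [hCx, hCy]
    simp
  have hSxy : Sy - Sx = C * Matrix.diagonal (fun i => d i - 1) * C.transpose := by
    have : Matrix.diagonal (fun i => d i - 1) =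
        Matrix.diagonal d - (1 : Matrix (Fin n) (Fin n) ℝ) := by
      ext i j
      by_cases h : i = j
      · subst h; simp
      · simp [h]
    rw [this, Matrix.mul_sub, Matrix.sub_mul, Matrix.mul_one, ← hCx, ← hCy]
  have hAu : IsUnit A := by
    rw [Matrix.isUnit_iff_isUnit_det, isUnit_iff_ne_zero]
    intro h0
    have h := hSx.det_pos
    rw [← hA, Matrix.det_mul, h0, mul_zero] at h
    exact h.false
  have hlawX : P.map X = volume.withDensity fun x => ENNReal.ofReal (φ 0 x) := by
    have h := (hφ 0 h01).2.2
    simp only [interp, zero_smul, sub_zero, one_smul, zero_add] at h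
    exact hXell.unique h
  have hlawY : P'.map Y = volume.withDensity fun x => ENNReal.ofReal (φ 1 x) := by
    have h := (hφ 1 h11).2.2
    simp only [interp, one_smul, sub_self, zero_smul, add_zero] at h
    exact hYell.unique h
  have hM : 0 < ∫ r, r ^ 2 ∂ρ := by
    rw [hρM]
    refine integral_sq_pos_of_absolutelyContinuous hn hR2 hXR.aemeasurable_snd
      (fun ω => rfl) ?_
    rw [← hXR.map_eq, hlawX]
    exact withDensity_absolutelyContinuous _ _
  -- `R U` is spherical with generator `ψ`
  have hν₀ : ∀ u, charFun (sphereMixture n ρ) u = (ψ (‖u‖ ^ 2) : ℝ) := by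
    refine charFun_eq_of_isEllipticalLaw_map (m := mx) hAu ?_
    have hc' : Continuous fun z => mx + mulVec A.transpose z := by
      unfold mulVec
      fun_prop
    have hRUm : AEMeasurable (fun ω => R ω • U ω) P₀ := hR.smul hU.aemeasurable
    rw [hA, hρdef, sphereMixture_eq_map hR hU hRU, AEMeasurable.map_map_of_aemeasurable
      hc'.aemeasurable hRUm]
    rw [hXR.map_eq] at hXell
    convert hXell using 2
    ext ω
    simp [mulVec, Matrix.mulVec_smul]
  have hν₁ := charFun_ballMixture hn hρ hM
  have := isProbabilityMeasure_sphereMixture hn ρ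
  have := isProbabilityMeasure_ballMixture (n := n) hρ hM
  have hell₀ : ∀ l ∈ Set.Icc (0 : ℝ) 1, IsEllipticalLaw (interp mx my l) (interp Sx Sy l) ψ
      ((sphereMixture n ρ).map (path c mx my d l)) := fun l hl =>
    isEllipticalLaw_map_diagAffine hν₀ (hS l hl)
  have hell₁ : ∀ l ∈ Set.Icc (0 : ℝ) 1, IsEllipticalLaw (interp mx my l) (interp Sx Sy l)
      (psi1 n ρ) ((ballMixture n ρ).map (path c mx my d l)) := fun l hl =>
    isEllipticalLaw_map_diagAffine hν₁ (hS l hl)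
  refine ⟨fun l hl => (hell₁ l hl).exists_density (map_diagAffine_absolutelyContinuous
    (ballMixture_absolutelyContinuous ρ) hcli _ fun i => (scale_pos hd hl i).ne'),
    fun φ₁ hφ₁ hint => ?_⟩
  have hpc : ∀ l, Continuous (path c mx my d l) := fun l => continuous_diagAffine _ _ _
  have hgc : Continuous fun x => fderiv ℝ f x (my - mx) :=
    (hf.continuous_fderiv two_ne_zero).clm_apply continuous_const
  let q : EuclideanSpace ℝ (Fin n) → ℝ := fun x =>
    ∑ i, (d i - 1) * fderiv ℝ (fun y => fderiv ℝ f y (c i)) x (c i)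
  have hq : ∀ x, ((Sy - Sx) * hessian f x).trace = q x := trace_mul_hessian hSxy hf
  have hqc : Continuous q := by
    have hf1 : ContDiff ℝ 1 (fderiv ℝ f) := hf.fderiv_right (by norm_num)
    refine continuous_finsetSum _ fun i _ => continuous_const.mul ?_
    exact ((hf1.clm_apply contDiff_const).continuous_fderiv one_ne_zero).clm_apply
      continuous_const
  have hφlaw : ∀ l ∈ Set.Icc (0 : ℝ) 1, (volume.withDensity fun x => ENNReal.ofReal (φ l x)) =
      (sphereMixture n ρ).map (path c mx my d l) := fun l hl =>
    (hφ l hl).2.2.unique (hell₀ l hl)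
  have hφ₁law : ∀ l ∈ Set.Icc (0 : ℝ) 1, (volume.withDensity fun x => ENNReal.ofReal (φ₁ l x)) =
      (ballMixture n ρ).map (path c mx my d l) := fun l hl =>
    (hφ₁ l hl).2.2.unique (hell₁ l hl)
  -- all integrals, transported to the spherical laws
  have hg : ∀ l ∈ Set.Icc (0 : ℝ) 1, ∫ x, inner ℝ (my - mx) (gradient f x) * φ l x =
      ∫ z, fderiv ℝ f (path c mx my d l z) (my - mx) ∂(sphereMixture n ρ) := by
    intro l hl
    simp only [inner_gradient]
    rw [integral_mul_density (hφ l hl).1 (hφ l hl).2.1, hφlaw l hl,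
      integral_map (hpc l).aemeasurable hgc.aestronglyMeasurable]
  have hh : ∀ l ∈ Set.Icc (0 : ℝ) 1, ∫ x, ((Sy - Sx) * hessian f x).trace * φ₁ l x =
      ∫ z, q (path c mx my d l z) ∂(ballMixture n ρ) := by
    intro l hl
    simp only [hq]
    rw [integral_mul_density (hφ₁ l hl).1 (hφ₁ l hl).2.1, hφ₁law l hl,
      integral_map (hpc l).aemeasurable hqc.aestronglyMeasurable]
  have hfX : ∫ ω, f (X ω) ∂P = ∫ z, f (path c mx my d 0 z) ∂(sphereMixture n ρ) := by
    rw [← integral_map hX hf.continuous.aestronglyMeasurable, hlawX, hφlaw 0 h01,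
      integral_map (hpc 0).aemeasurable hf.continuous.aestronglyMeasurable]
  have hfY : ∫ ω, f (Y ω) ∂P' = ∫ z, f (path c mx my d 1 z) ∂(sphereMixture n ρ) := by
    rw [← integral_map hY hf.continuous.aestronglyMeasurable, hlawY, hφlaw 1 h11,
      integral_map (hpc 1).aemeasurable hf.continuous.aestronglyMeasurable]
  obtain ⟨K₀, hK₀0, hK₀⟩ := exists_linear_growth hf.continuous hfO
  have hgrad : Continuous (gradient f) :=
    (InnerProductSpace.toDual ℝ _).symm.continuous.comp (hf.continuous_fderiv two_ne_zero)
  obtain ⟨K, hK0, hK'⟩ := exists_linear_growth hgrad hgO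
  have hK : ∀ x, ‖fderiv ℝ f x‖ ≤ K * (1 + ‖x‖) := fun x => by
    have := hK' x
    rwa [gradient, LinearIsometryEquiv.norm_map] at this
  obtain ⟨hm2, hz2, hmi, hzi, hmain⟩ :=
    integral_path_sub hn hρ c mx my hd hf hK₀0 hK₀ hK0 hK
  have hM0 : (∫ r, r ^ 2 ∂ρ) / (2 * n) ≠ 0 := by positivity
  -- the Stein-type identity, for almost every point of the segment
  have hst : ∀ᵐ l ∂(volume.restrict (Set.Icc (0 : ℝ) 1)),
      ∫ z, fderiv ℝ f (path c mx my d l z) (diagAffine c 0 (rate d l) z) ∂(sphereMixture n ρ) =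
        (∫ r, r ^ 2 ∂ρ) / (2 * n) * ∫ x, ((Sy - Sx) * hessian f x).trace * φ₁ l x := by
    filter_upwards [hint, ae_restrict_mem measurableSet_Icc] with l hil hl
    rw [hh l hl]
    refine integral_fderiv_path_eq hn hρ hM c mx my hd hf hl (hz2 l hl) ?_
    simp only [hq] at hil
    rw [integrable_mul_density_iff (hφ₁ l hl).1 (hφ₁ l hl).2.1, hφ₁law l hl,
      integrable_map_measure hqc.aestronglyMeasurable (hpc l).aemeasurable] at hil
    exact hil
  have hst' : ∀ᵐ l ∂(volume.restrict (Set.uIoc (0 : ℝ) 1)),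
      ∫ z, fderiv ℝ f (path c mx my d l z) (diagAffine c 0 (rate d l) z) ∂(sphereMixture n ρ) =
        (∫ r, r ^ 2 ∂ρ) / (2 * n) * ∫ x, ((Sy - Sx) * hessian f x).trace * φ₁ l x := by
    rw [Set.uIoc_of_le zero_le_one]
    exact ae_restrict_of_ae_restrict_of_subset Set.Ioc_subset_Icc_self hst
  have hgI : Set.EqOn (fun l => ∫ x, inner ℝ (my - mx) (gradient f x) * φ l x)
      (fun l => ∫ z, fderiv ℝ f (path c mx my d l z) (my - mx) ∂(sphereMixture n ρ))
      (Set.uIcc (0 : ℝ) 1) := by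
    rw [Set.uIcc_of_le zero_le_one]
    exact hg
  refine ⟨?_, ?_, ?_, ?_, ?_, ?_⟩
  · have : Integrable f (P.map X) := by
      rw [hlawX, hφlaw 0 h01, integrable_map_measure hf.continuous.aestronglyMeasurable
        (hpc 0).aemeasurable]
      exact integrable_comp_path hn hρ c mx my d hf.continuous hK₀0 hK₀ h01
    exact (integrable_map_measure hf.continuous.aestronglyMeasurable hX).1 this
  · have : Integrable f (P'.map Y) := by
      rw [hlawY, hφlaw 1 h11, integrable_map_measure hf.continuous.aestronglyMeasurable
        (hpc 1).aemeasurable]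
      exact integrable_comp_path hn hρ c mx my d hf.continuous hK₀0 hK₀ h11
    exact (integrable_map_measure hf.continuous.aestronglyMeasurable hY).1 this
  · intro l hl
    simp only [inner_gradient]
    rw [integrable_mul_density_iff (hφ l hl).1 (hφ l hl).2.1, hφlaw l hl,
      integrable_map_measure hgc.aestronglyMeasurable (hpc l).aemeasurable]
    exact hm2 l hl
  · exact hmi.congr (fun l hl => (hgI (Set.uIoc_subset_uIcc hl)).symm)
  · have h := (hzi.congr_ae hst').const_mul ((∫ r, r ^ 2 ∂ρ) / (2 * n))⁻¹
    simpa only [inv_mul_cancel_left₀ hM0] using h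
  · rw [hfX, hfY, hmain, intervalIntegral.integral_congr hgI,
      intervalIntegral.integral_congr_ae_restrict hst', intervalIntegral.integral_const_mul, hρM]
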